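/- Let $\varepsilon>0$, let $K(x,y)=\exp\bigl(-\tfrac12\varepsilon^2(x-y)^2\bigr)$ be the Gaussian kernel on $[-1,1]\times[-1,1]$, and let $H(K)$ be its reproducing kernel Hilbert space, with norm $\|\cdot\|_K$. For a Lebesgue measurable $f\colon[-1,1]\to\mathbb R$ put $\|f\|_\infty=\sup_{x\in[-1,1]}|f(x)|$ and $\|f\|_2=\bigl(\int_{-1}^1 f(x)^2\,dx\bigr)^{1/2}$ (both may be infinite). A linear approximation is a map $A_nf=\sum_{k=1}^n f(x_k)\psi_k$ on $H(K)$, where $x_1,\dots,x_n\in[-1,1]$ are pairwise distinct points and $\psi_1,\dots,\psi_n\colon[-1,1]\to\mathbb R$ are Lebesgue measurable functions. For $p\in\{2,\infty\}$ let $$e_p(A_n)=\sup_{0\ne f\in H(K)}\frac{\|f-A_nf\|_p}{\|f\|_K},\qquad e_p^{\min}(n)=\inf_{A_n}e_p(A_n),$$ the infimum being over all linear approximations with $n$ points. For $\lambda>0$ let $$c_L(\lambda)=\frac{e^{-\frac32\lambda+2\sqrt\lambda}}{2\sqrt\pi\,\lambda^{1/4}}\Bigl(3+\sqrt{\tfrac{\pi}{e}}+\frac{2}{\sqrt\pi\,\lambda^{1/4}}+\frac{7}{16\sqrt\lambda}+\sqrt\lambda\,(2+\lambda)\Bigr),\qquad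 m_L(\lambda)=\max\Bigl\{5\lambda,\ \lambda\bigl(1+\tfrac{\lambda}{2}\bigr)^2,\ \tfrac{9}{\lambda}\Bigr\},$$ and let $$c_{1,\infty}=\sqrt{\frac{2}{1+\varepsilon^2}}\;e^{-\frac1{32}\varepsilon^4-\frac12\varepsilon^2},\qquad c_{1,2}=\frac{2\sqrt{2\pi}}{3e^3\sqrt{4+\varepsilon^2}}\;e^{-\frac1{32}\varepsilon^4-\frac12\varepsilon^2}.$$ Let $n$ be a natural number with $n\ge m_L(\varepsilon^2)$. (a) For each $p\in\{2,\infty\}$ (with $1/\infty=0$), $$c_{1,p}\Bigl(\frac{\varepsilon}{2}\Bigr)^n(n!)^{-1/2}\le e_p^{\min}(n)\le 2\sqrt{2c_L(\varepsilon^2)}\;n^{-1/8}e^{\varepsilon\sqrt n}\Bigl(\frac{\varepsilon}{2}\Bigr)^n(n!)^{-1/2},$$ and for any pairwise distinct $x_1,\dots,x_n\in[-1,1]$ there is a linear approximation $A_n$ that uses these points such that $$c_{1,p}\Bigl(\frac{\varepsilon}{2}\Bigr)^n(n!)^{-1/2}\le e_p(A_n)\le \sqrt{2c_L(\varepsilon^2)}\;n^{-1/8-1/p}e^{\varepsilon\sqrt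 n}(2\varepsilon)^n(n!)^{-1/2}.$$ (b) For $p=\infty$ the following sharper form holds, with $c_1=c_{1,\infty}$ and $c_2=2\sqrt{c_L(\varepsilon^2)}$: $$c_1\Bigl(\frac{\varepsilon}{2}\Bigr)^n(n!)^{-1/2}\le e_\infty^{\min}(n)\le c_2\,n^{-1/8}e^{\varepsilon\sqrt n}\Bigl(\frac{\varepsilon}{2}\Bigr)^n(n!)^{-1/2},$$ and for any pairwise distinct $x_1,\dots,x_n\in[-1,1]$ there is a linear approximation $A_n$ that uses these points such that $$c_1\Bigl(\frac{\varepsilon}{2}\Bigr)^n(n!)^{-1/2}\le e_\infty(A_n)\le \frac{c_2}{2}\,n^{-1/8}e^{\varepsilon\sqrt n}(2\varepsilon)^n(n!)^{-1/2}.$$ -/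

import Mathlib

open scoped ENNReal Nat

noncomputable section

namespace GaussApprox

/-- The interval `[-1, 1]`, as a type. -/
abbrev I : Type := Set.Icc (-1 : ℝ) 1

/-- Lebesgue measure on `[-1, 1]`. -/
abbrev lebesgue : MeasureTheory.Measure I :=
  MeasureTheory.Measure.comap ((↑) : I → ℝ) MeasureTheory.volume

/-! ### The Gaussian kernel and its reproducing kernel Hilbert space -/

/-- The Gaussian kernel `K(x, y) = exp(-ε² (x - y)² / 2)` on `[-1, 1] × [-1, 1]`. -/
def gaussianKernel (ε : ℝ) (x y : I) : ℝ :=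
  Real.exp (-(1 / 2) * ε ^ 2 * ((x : ℝ) - y) ^ 2)

/-- The Gaussian kernel in the form used for (vector-valued) reproducing kernel Hilbert spaces:
the entry at `(x, y)` is multiplication by `K(x, y)` on `ℝ`. -/
def gaussianMatrix (ε : ℝ) : Matrix I I (ℝ →L[ℝ] ℝ) :=
  Matrix.of fun x y => gaussianKernel ε x y • ContinuousLinearMap.id ℝ ℝ

/-- The Gaussian kernel is positive semidefinite, so that it has a reproducing kernel Hilbert
space. -/
theorem posSemidef_gaussianMatrix (ε : ℝ) : (gaussianMatrix ε).PosSemidef := by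
  have tfae := (RKHS.posSemidef_tfae (K := gaussianMatrix ε)).out 0 2
  refine tfae.mpr ⟨?_, fun v => ?_⟩
  · ext x y
    simp only [gaussianMatrix, gaussianKernel, Matrix.conjTranspose_apply, Matrix.of_apply,
      ContinuousLinearMap.star_eq_adjoint, map_smulₛₗ, ContinuousLinearMap.adjoint_id]
    simp
    exact Or.inl (by ring)
  · have key : ∀ x y : I, HasSum
        (fun k : ℕ => (Real.exp (-(1 / 2) * ε ^ 2 * (x : ℝ) ^ 2) * (ε * x) ^ k) *
          (Real.exp (-(1 / 2) * ε ^ 2 * (y : ℝ) ^ 2) * (ε * y) ^ k) / k !)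
        (gaussianKernel ε x y) := by
      intro x y
      have h := (NormedSpace.expSeries_div_hasSum_exp ((ε * x) * (ε * y) : ℝ)).mul_left
        (Real.exp (-(1 / 2) * ε ^ 2 * (x : ℝ) ^ 2) * Real.exp (-(1 / 2) * ε ^ 2 * (y : ℝ) ^ 2))
      rw [← Real.exp_eq_exp_ℝ, ← Real.exp_add, ← Real.exp_add] at h
      convert! h using 1
      · ext k
        rw [mul_pow (ε * (x : ℝ)), Real.exp_add]
        ring
      · rw [gaussianKernel]
        congr 1
        ring
    have hs := hasSum_sum (s := v.support) fun x _ => hasSum_sum (s := v.support) fun y _ =>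
      (key y x).mul_left (v x * v y)
    have h0 : ∀ k : ℕ, 0 ≤ ∑ x ∈ v.support, ∑ y ∈ v.support, v x * v y *
        ((Real.exp (-(1 / 2) * ε ^ 2 * (y : ℝ) ^ 2) * (ε * y) ^ k) *
          (Real.exp (-(1 / 2) * ε ^ 2 * (x : ℝ) ^ 2) * (ε * x) ^ k) / k !) := by
      intro k
      have : ∑ x ∈ v.support, ∑ y ∈ v.support, v x * v y *
        ((Real.exp (-(1 / 2) * ε ^ 2 * (y : ℝ) ^ 2) * (ε * y) ^ k) *
          (Real.exp (-(1 / 2) * ε ^ 2 * (x : ℝ) ^ 2) * (ε * x) ^ k) / k !) =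
          (∑ x ∈ v.support, v x * (Real.exp (-(1 / 2) * ε ^ 2 * (x : ℝ) ^ 2) * (ε * x) ^ k)) ^ 2
            / k ! := by
        rw [pow_two (∑ x ∈ v.support, _), Finset.sum_mul_sum, Finset.sum_div]
        refine Finset.sum_congr rfl fun x _ => ?_
        rw [Finset.sum_div]
        refine Finset.sum_congr rfl fun y _ => ?_
        ring
      rw [this]
      positivity
    have := hs.nonneg h0
    simp only [Finsupp.sum, gaussianMatrix, Matrix.of_apply]
    convert! this using 1
    simp
    refine Finset.sum_congr rfl fun x _ => Finset.sum_congr rfl fun y _ => ?_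
    ring

instance (ε : ℝ) : Fact (gaussianMatrix ε).PosSemidef := ⟨posSemidef_gaussianMatrix ε⟩

/-- `H(K)`, the reproducing kernel Hilbert space of the Gaussian kernel. Its elements are
coerced to functions `[-1, 1] → ℝ`, and `‖f‖` is the norm `‖f‖_K`. -/
abbrev GaussianRKHS (ε : ℝ) : Type := RKHS.OfKernel (gaussianMatrix ε)

/-! ### Norms, linear approximations and worst-case errors -/

/-- `‖f‖_∞ = sup_{x ∈ [-1, 1]} |f(x)|` (a true supremum) for `p = ∞`, and
`‖f‖_p = (∫_{-1}^1 |f(x)|^p dx)^{1/p}` for finite `p`. The value may be infinite. -/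
def pNorm (p : ℝ≥0∞) (f : I → ℝ) : ℝ≥0∞ :=
  if p = ∞ then ⨆ x, ‖f x‖ₑ else (∫⁻ x, ‖f x‖ₑ ^ p.toReal ∂lebesgue) ^ (1 / p.toReal)

/-- The data of a linear approximation `A_n f = ∑_{k=1}^n f(x_k) ψ_k`: pairwise distinct points
`x_k ∈ [-1, 1]` and Lebesgue measurable functions `ψ_k : [-1, 1] → ℝ`. -/
structure LinearApprox (n : ℕ) where
  /-- the sampling points `x_k` -/
  point : Fin n → I
  /-- the sampling points are pairwise distinct -/
  point_injective : Function.Injective point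
  /-- the functions `ψ_k` -/
  ψ : Fin n → I → ℝ
  /-- the functions `ψ_k` are Lebesgue measurable, i.e. measurable for the completed measure -/
  measurable_ψ : ∀ k, MeasureTheory.NullMeasurable (ψ k) lebesgue

/-- `A_n f = ∑_{k=1}^n f(x_k) ψ_k`. -/
def LinearApprox.apply {n : ℕ} (A : LinearApprox n) (f : I → ℝ) : I → ℝ :=
  fun x => ∑ k, f (A.point k) * A.ψ k x

/-- The worst-case error `e_p(A_n) = sup_{0 ≠ f ∈ H(K)} ‖f - A_n f‖_p / ‖f‖_K`. -/
def worstCaseError (ε : ℝ) (p : ℝ≥0∞) {n : ℕ} (A : LinearApprox n) : ℝ≥0∞ :=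
  ⨆ (f : GaussianRKHS ε) (_ : f ≠ 0), pNorm p (⇑f - A.apply ⇑f) / ‖f‖ₑ

/-- The `n`th minimal error `e_p^min(n) = inf_{A_n} e_p(A_n)`. -/
def minimalError (ε : ℝ) (p : ℝ≥0∞) (n : ℕ) : ℝ≥0∞ :=
  ⨅ A : LinearApprox n, worstCaseError ε p A

/-! ### Constants -/

/-- The function `c_L`. -/
def cL (l : ℝ) : ℝ :=
  Real.exp (-(3 / 2) * l + 2 * √l) / (2 * √Real.pi * l ^ (1 / 4 : ℝ)) *
    (3 + √(Real.pi / Real.exp 1) + 2 / (√Real.pi * l ^ (1 / 4 : ℝ)) + 7 / (16 * √l) +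
      √l * (2 + l))

/-- The function `m_L`. -/
def mL (l : ℝ) : ℝ :=
  max (5 * l) (max (l * (1 + l / 2) ^ 2) (9 / l))

/-- The constants `c_{1,∞}` and `c_{1,2}` (the latter is used only for `p = 2`), as functions of
`λ` and `φ_min`. -/
def cLower (p : ℝ≥0∞) (l φmin : ℝ) : ℝ :=
  if p = ∞ then √(2 / (1 + l)) * Real.exp (-(1 / 32) * l ^ 2) * φmin
  else 2 * √(2 * Real.pi) / (3 * Real.exp 1 ^ 3 * √(4 + l)) * Real.exp (-(1 / 32) * l ^ 2) * φmin

end GaussApprox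

end

noncomputable section

namespace GaussApprox

/-! ### Feature maps and entire extensions of functions in `H(K)` -/

section

open InnerProductSpace

/-! Upper bounds: subtracting from `f` its orthogonal projection onto the kernel sections at the
nodes gives a linear approximation whose error function vanishes at the nodes and has norm at most
`‖f‖` (`exists_linearApprox_interpolating`). Centred at a point `y`, a function of `H(K)` is a
Gaussian factor times an entire `g` with `‖g z‖ ≤ ‖f‖ e^{ε²|z|²/2}`. A Jensen-type estimate dividing
out the `n` zeros, on the circle of radius `√n/ε`, gives the error at `y` as at most `∏ |y - x_k| ·
(ε/√n)^n e^{n/2} ‖f‖` (`abs_le_of_vanish`). By Stirling this power is at most `√(e√n) ε^n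
(n!)^{-1/2}`, and the factor `e^{ε√n}` of the claim absorbs the surplus. It remains to bound the
nodal polynomial: by `2^{1-n}` for Chebyshev nodes, by `(1+|y|)^n` in general.

Lower bounds: for nodal polynomial `q`, the function `e^{-ε²x²/2} q(x)` is annihilated by `A`, so
its norm must be bounded above by a norm of `q` on `[-1,1]`. Its squared `H(K)` norm is at most a
sum of squared coefficients of `q` with weights `j!/ε^{2j}`. Expanding `q` in Chebyshev polynomials
of the second kind, orthogonal for `√(1-x²) dx`, and using their explicit coefficients,
`coeff_sq_le_and_sum_coeff_sq_le` bounds that sum by its top weight times `4^n`, a factor depending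
only on `ε`, and the `L²` or sup norm squared. -/

/-- A feature map `Φ` of the kernel of a reproducing kernel Hilbert space induces a contraction
into the feature space. -/
theorem exists_featureCLM {X H E : Type*} [NormedAddCommGroup H] [InnerProductSpace ℝ H]
    [CompleteSpace H] [RKHS ℝ H X ℝ] [NormedAddCommGroup E] [InnerProductSpace ℝ E]
    [CompleteSpace E] (Φ : X → E)
    (hΦ : ∀ x y, RKHS.kernel H x y 1 = ⟪Φ x, Φ y⟫_ℝ) :
    ∃ J : H →L[ℝ] E, ‖J‖ ≤ 1 ∧ (∀ f x, f x = ⟪Φ x, J f⟫_ℝ) ∧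
      ∀ a x, (J.adjoint a) x = ⟪Φ x, a⟫_ℝ := by
  set k : X → H := fun x => RKHS.kerFun H x 1 with hk
  have hkf : ∀ x (f : H), ⟪k x, f⟫_ℝ = f x := fun x f => by simp [hk]
  have hkk : ∀ x y, ⟪k x, k y⟫_ℝ = ⟪Φ x, Φ y⟫_ℝ := fun x y => by
    rw [hkf, ← hΦ, hk, RKHS.kerFun_apply]
  set G := Finsupp.linearCombination ℝ k
  set L := Finsupp.linearCombination ℝ Φ
  -- Kernel sections and feature vectors have the same Gram matrix, so `k x ↦ Φ x` is isometric on a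
  -- dense span and extends to `J`.
  have hGL : ∀ c, ‖L c‖ = ‖G c‖ := fun c => by
    rw [norm_eq_sqrt_real_inner, norm_eq_sqrt_real_inner]
    simp only [G, L, Finsupp.linearCombination_apply, Finsupp.sum, sum_inner, inner_sum,
      inner_smul_left, inner_smul_right, hkk]
  have hdense : DenseRange G := by
    have h := RKHS.kerFun_dense (𝕜 := ℝ) (X := X) (V := ℝ) H
    rw [← Submodule.dense_iff_topologicalClosure_eq_top] at h
    refine h.mono ?_
    have : Submodule.span ℝ {x | ∃ (y : X) (v : ℝ), RKHS.kerFun H y v = x} ≤ LinearMap.range G := by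
      rw [Submodule.span_le]
      rintro _ ⟨x, v, rfl⟩
      refine ⟨Finsupp.single x v, ?_⟩
      simp [G, hk, ← map_smul]
    exact fun x hx => this hx
  have hn : ∀ c, ‖L c‖ ≤ 1 * ‖G c‖ := fun c => by rw [one_mul, hGL]
  set J := L.extendOfNorm G
  have hJ : ∀ x, J (k x) = Φ x := fun x => by
    have := LinearMap.extendOfNorm_eq hdense ⟨1, hn⟩ (Finsupp.single x 1)
    simpa [G, L] using this
  have hadj : ∀ a x, (J.adjoint a) x = ⟪Φ x, a⟫_ℝ := fun a x => by
    rw [← hkf, ContinuousLinearMap.adjoint_inner_right, hJ]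
  refine ⟨J, LinearMap.opNorm_extendOfNorm_le hdense zero_le_one hn, fun f x => ?_, hadj⟩
  rw [← ContinuousLinearMap.adjoint_inner_left]
  have : J.adjoint (Φ x) = k x := by
    ext y
    rw [hadj, ← hkk, hkf]
  rw [this, hkf]

/-- The coefficients `(ε r)^k / √k!` of the feature map of the Gaussian kernel. -/
def expFeature (ε r : ℝ) (k : ℕ) : ℝ := (ε * r) ^ k / √(k ! : ℝ)

theorem hasSum_expFeature_mul (ε r s : ℝ) :
    HasSum (fun k => expFeature ε r k * expFeature ε s k) (Real.exp (ε ^ 2 * (r * s))) := by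
  have h := NormedSpace.expSeries_div_hasSum_exp ((ε * r) * (ε * s) : ℝ)
  rw [← Real.exp_eq_exp_ℝ] at h
  convert! h using 1
  · ext k
    have : √(k ! : ℝ) * √(k ! : ℝ) = k ! := Real.mul_self_sqrt (by positivity)
    rw [expFeature, expFeature, div_mul_div_comm, this, mul_pow (ε * r)]
  · congr 1; ring

theorem memℓp_expFeature (ε r : ℝ) : Memℓp (expFeature ε r) 2 := by
  refine memℓp_gen ?_
  simpa [sq] using (hasSum_expFeature_mul ε r r).summable

/-- The feature map `x ↦ (e^{-ε²(x-c)²/2} (ε(x-c))^k / √k!)_k` of the Gaussian kernel, expanded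
around `c`. -/
def gaussianFeature (ε c : ℝ) (x : I) : lp (fun _ : ℕ => ℝ) 2 :=
  Real.exp (-(1 / 2) * ε ^ 2 * ((x : ℝ) - c) ^ 2) • ⟨expFeature ε (x - c), memℓp_expFeature ε _⟩

theorem inner_gaussianFeature_left (ε c : ℝ) (x : I) (a : lp (fun _ : ℕ => ℝ) 2) :
    ⟪gaussianFeature ε c x, a⟫_ℝ = Real.exp (-(1 / 2) * ε ^ 2 * ((x : ℝ) - c) ^ 2) *
      ∑' k, a k * expFeature ε (x - c) k := by
  rw [gaussianFeature, inner_smul_left, lp.inner_eq_tsum]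
  simp

/-- Completing the square makes the centre `c` cancel. This freedom is used later: `c` is the
evaluation point in the upper bound and `0` in the lower bound. -/
theorem inner_gaussianFeature (ε c : ℝ) (x y : I) :
    ⟪gaussianFeature ε c x, gaussianFeature ε c y⟫_ℝ = gaussianKernel ε x y := by
  rw [inner_gaussianFeature_left]
  simp only [gaussianFeature, lp.coeFn_smul, Pi.smul_apply, smul_eq_mul, mul_assoc]
  rw [tsum_mul_left, (hasSum_expFeature_mul ε _ _).tsum_eq, ← Real.exp_add, ← Real.exp_add,
    gaussianKernel]
  congr 1
  ring

theorem exists_gaussianFeatureCLM (ε c : ℝ) :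
    ∃ J : GaussianRKHS ε →L[ℝ] lp (fun _ : ℕ => ℝ) 2, ‖J‖ ≤ 1 ∧
      (∀ f x, f x = ⟪gaussianFeature ε c x, J f⟫_ℝ) ∧
      ∀ a x, (J.adjoint a) x = ⟪gaussianFeature ε c x, a⟫_ℝ :=
  exists_featureCLM _ fun x y => by
    rw [RKHS.OfKernel.kernel_ofKernel, inner_gaussianFeature]
    simp [gaussianMatrix]

/-- Functions in `H(K)` are, up to a Gaussian factor centred at `c`, restrictions of entire
functions of controlled growth. -/
theorem exists_entire_of_gaussianRKHS {ε : ℝ} (hε : 0 < ε) (c : ℝ) (f : GaussianRKHS ε) :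
    ∃ g : ℂ → ℂ, Differentiable ℂ g ∧
      (∀ z, ‖g z‖ ≤ ‖f‖ * Real.exp (ε ^ 2 * ‖z‖ ^ 2 / 2)) ∧
      ∀ x : I, ((f x : ℝ) : ℂ) =
        Real.exp (-(1 / 2) * ε ^ 2 * ((x : ℝ) - c) ^ 2) * g (((x : ℝ) - c : ℝ) : ℂ) := by
  obtain ⟨J, hJ, hf, -⟩ := exists_gaussianFeatureCLM ε c
  set a := J f
  have ha : ‖a‖ ≤ ‖f‖ := by simpa using J.le_of_opNorm_le hJ f
  have hasum : HasSum (fun k => ‖a k‖ ^ 2) (‖a‖ ^ 2) := by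
    simpa using lp.hasSum_norm (p := 2) (by norm_num) a
  set F : ℕ → ℂ → ℂ := fun k z => a k * ((ε * z) ^ k / (√(k ! : ℝ) : ℝ))
  have hF : ∀ k z, ‖F k z‖ = ‖a k‖ * expFeature ε ‖z‖ k := fun k z => by
    simp [F, expFeature, abs_of_pos hε, abs_of_nonneg (Real.sqrt_nonneg _)]
  have hnn : ∀ (z : ℂ) k, 0 ≤ expFeature ε ‖z‖ k := fun z k => by
    unfold expFeature; positivity
  have hsq : ∀ z : ℂ, HasSum (fun k => expFeature ε ‖z‖ k ^ 2) (Real.exp (ε ^ 2 * ‖z‖ ^ 2)) :=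
    fun z => by simpa [sq] using hasSum_expFeature_mul ε ‖z‖ ‖z‖
  -- Cauchy–Schwarz gives absolute convergence and the growth bound at once.
  have hCS : ∀ z : ℂ, Summable (fun k => ‖F k z‖) ∧
      ∑' k, ‖F k z‖ ≤ ‖a‖ * Real.exp (ε ^ 2 * ‖z‖ ^ 2 / 2) := fun z => by
    have h := Real.summable_and_inner_le_Lp_mul_Lq_tsum_of_nonneg
      (Real.HolderConjugate.two_two) (f := fun k => ‖a k‖) (g := expFeature ε ‖z‖)
      (fun _ => norm_nonneg _) (hnn z) (by exact_mod_cast hasum.summable)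
      (by exact_mod_cast (hsq z).summable)
    simp only [hF]
    refine ⟨h.1, h.2.trans_eq ?_⟩
    have h1 : ∑' k, ‖a k‖ ^ (2 : ℝ) = ‖a‖ ^ 2 := by exact_mod_cast hasum.tsum_eq
    have h2 : ∑' k, expFeature ε ‖z‖ k ^ (2 : ℝ) = Real.exp (ε ^ 2 * ‖z‖ ^ 2) := by
      exact_mod_cast (hsq z).tsum_eq
    rw [h1, h2, ← Real.sqrt_eq_rpow, ← Real.sqrt_eq_rpow, Real.sqrt_sq (norm_nonneg _),
      Real.exp_half]
  refine ⟨fun z => ∑' k, F k z, ?_, fun z => ?_, fun x => ?_⟩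
  · intro z
    have hball : z ∈ Metric.ball (0 : ℂ) (‖z‖ + 1) := by simp
    refine (Complex.differentiableOn_tsum_of_summable_norm
      (u := fun k => ‖F k ((‖z‖ + 1 : ℝ) : ℂ)‖) (hCS _).1 (fun k => ?_) Metric.isOpen_ball
      fun k w hw => ?_).differentiableAt (Metric.isOpen_ball.mem_nhds hball)
    · exact Differentiable.differentiableOn (by fun_prop)
    · rw [hF, hF, expFeature, expFeature]
      have : ‖w‖ ≤ ‖((‖z‖ + 1 : ℝ) : ℂ)‖ := by
        rw [Complex.norm_real, Real.norm_of_nonneg (by positivity)]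
        simpa using (Metric.mem_ball.mp hw).le
      gcongr
  · calc ‖∑' k, F k z‖ ≤ ∑' k, ‖F k z‖ := norm_tsum_le_tsum_norm (hCS z).1
      _ ≤ _ := (hCS z).2
      _ ≤ _ := by gcongr
  · rw [hf, inner_gaussianFeature_left]
    push_cast
    congr 2
    ext k
    simp [F, expFeature, a]

theorem continuous_gaussianRKHS {ε : ℝ} (hε : 0 < ε) (f : GaussianRKHS ε) : Continuous f := by
  obtain ⟨g, hg, -, hfg⟩ := exists_entire_of_gaussianRKHS hε 0 f
  have : (f : I → ℝ) = fun x : I => (((f x : ℝ) : ℂ)).re := by simp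
  rw [this]
  simp only [hfg]
  have := hg.continuous
  fun_prop

end

/-! ### Functions with prescribed zeros, and interpolation -/

section

/-- An entire function vanishing on a finite set `s` of real points is small at the origin. -/
theorem norm_apply_zero_mul_pow_le_of_vanish {R M : ℝ} (hR : 0 < R) (s : Finset ℝ) :
    ∀ g : ℂ → ℂ, Differentiable ℂ g → (∀ w, ‖w‖ = R → ‖g w‖ ≤ M) → (∀ a ∈ s, g (a : ℂ) = 0) →
      ‖g 0‖ * R ^ s.card ≤ (∏ a ∈ s, |a|) * M := by
  induction s using Finset.induction_on with
  | empty =>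
    intro g hg hM _
    have := Complex.norm_le_of_forall_mem_frontier_norm_le (U := Metric.ball (0 : ℂ) R)
      Metric.isBounded_ball (hg.diffContOnCl) (C := M) (fun w hw => hM w ?_)
      (subset_closure (Metric.mem_ball_self hR))
    · simpa using this
    · rw [frontier_ball _ hR.ne'] at hw
      simpa using hw
  | insert a s ha ih =>
    intro g hg hM hs
    have hga : g a = 0 := hs a (Finset.mem_insert_self _ _)
    have hG : Differentiable ℂ (dslope g a) := by
      rw [← differentiableOn_univ] at hg ⊢
      exact (Complex.differentiableOn_dslope Filter.univ_mem).mpr hg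
    have hmul : ∀ z, (z - a) * dslope g a z = g z := fun z => by
      simpa [hga] using sub_smul_dslope g (a : ℂ) z
    -- The zero `a` is replaced by the Blaschke partner `(R² - a z)/R`, which has modulus `|z - a|`
    -- on the circle and value `R` at the origin. The new function thus has the same modulus as `g`
    -- on the circle, and no restriction on `|a|` is needed.
    have key := ih (fun z => ((R : ℂ) ^ 2 - a * z) / R * dslope g a z) (by fun_prop)
      (fun w hw => ?_) (fun b hb => ?_)
    · have h0 : ‖g 0‖ = |a| * ‖dslope g a 0‖ := by
        rw [← hmul 0]; simp
      have h1 : ‖((R : ℂ) ^ 2 - a * 0) / R * dslope g a 0‖ = R * ‖dslope g a 0‖ := by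
        rw [norm_mul]
        congr 1
        simp [sq, abs_of_pos hR, hR.ne']
      simp only [h1] at key
      rw [Finset.card_insert_of_notMem ha, Finset.prod_insert ha, h0, pow_succ]
      calc _ = |a| * (R * ‖dslope g a 0‖ * R ^ s.card) := by ring
        _ ≤ |a| * ((∏ a ∈ s, |a|) * M) := by gcongr
        _ = _ := by ring
    · have h1 : ‖((R : ℂ) ^ 2 - a * w)‖ = R * ‖w - a‖ := by
        have h2 : (R : ℂ) ^ 2 = w * (starRingEnd ℂ) w := by
          rw [Complex.mul_conj', hw]
        rw [h2, mul_comm (a : ℂ), ← mul_sub, norm_mul, hw, ← RCLike.norm_conj (w - a)]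
        simp
      rw [norm_mul, norm_div, h1]
      have : R * ‖w - a‖ / ‖(R : ℂ)‖ = ‖w - a‖ := by
        rw [Complex.norm_real, Real.norm_of_nonneg hR.le]; field_simp
      rw [this, ← norm_mul, hmul]
      exact hM w hw
    · have hb0 := hs b (Finset.mem_insert_of_mem hb)
      have hne : (b : ℂ) - a ≠ 0 := by
        rw [sub_ne_zero]
        exact_mod_cast fun h : b = a => ha (h ▸ hb)
      rw [← hmul b] at hb0
      rw [(mul_eq_zero.mp hb0).resolve_left hne, mul_zero]

/-- A function in `H(K)` that vanishes at `n` points is small everywhere. -/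
theorem abs_le_of_vanish {ε : ℝ} (hε : 0 < ε) {n : ℕ} (hn : n ≠ 0) {x : Fin n → I}
    (hx : Function.Injective x) (f : GaussianRKHS ε) (hf : ∀ k, f (x k) = 0) (y : I) :
    |f y| ≤ (∏ k, |(y : ℝ) - x k|) *
      ((ε / √n) ^ n * Real.exp (n / 2)) * ‖f‖ := by
  obtain ⟨g, hg, hgn, hfg⟩ := exists_entire_of_gaussianRKHS hε y f
  have hn0 : (0 : ℝ) < n := by positivity
  -- This radius minimises `R^{-n} e^{ε²R²/2}`.
  set R := √n / ε with hR
  have hRpos : 0 < R := by positivity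
  have hinj : Function.Injective fun k => (x k : ℝ) - y :=
    fun i j h => hx (Subtype.ext (by simpa using h))
  have hRsq : ε ^ 2 * R ^ 2 = n := by
    rw [hR, div_pow, Real.sq_sqrt hn0.le]; field_simp
  have key := norm_apply_zero_mul_pow_le_of_vanish (M := Real.exp (n / 2) * ‖f‖) hRpos
    (Finset.univ.image fun k => (x k : ℝ) - y) g hg (fun w hw => ?_) (fun a ha => ?_)
  · rw [Finset.card_image_of_injective _ hinj, Finset.card_univ, Fintype.card_fin,
      Finset.prod_image fun i _ j _ h => hinj h] at key
    have h0 : |f y| = ‖g 0‖ := by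
      have := congrArg norm (hfg y)
      simpa using this
    have h1 : (ε / √n) ^ n = (R ^ n)⁻¹ := by rw [hR, ← inv_pow, inv_div]
    rw [h0, h1, ← le_div_iff₀ (by positivity)] at *
    refine key.trans_eq ?_
    simp only [abs_sub_comm]
    ring
  · refine (hgn w).trans_eq ?_
    rw [hw, hRsq, mul_comm]
  · obtain ⟨k, -, rfl⟩ := Finset.mem_image.mp ha
    have := hfg (x k)
    rw [hf k, Complex.ofReal_zero, eq_comm, mul_eq_zero] at this
    exact this.resolve_left (by exact_mod_cast (Real.exp_pos _).ne')

open InnerProductSpace in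
/-- For every choice of sampling points there is a linear approximation with these points that
interpolates at them and whose error function has norm at most `‖f‖`. -/
theorem exists_linearApprox_interpolating {ε : ℝ} (hε : 0 < ε) {n : ℕ} (x : Fin n → I)
    (hx : Function.Injective x) :
    ∃ A : LinearApprox n, A.point = x ∧ ∀ f : GaussianRKHS ε, ∃ g : GaussianRKHS ε,
      ⇑g = ⇑f - A.apply ⇑f ∧ ‖g‖ ≤ ‖f‖ ∧ ∀ k, g (x k) = 0 := by
  let H := GaussianRKHS ε
  let v : Fin n → H := fun k => RKHS.kerFun H (x k) 1
  have hv : ∀ k (f : H), ⟪v k, f⟫_ℝ = f (x k) := fun k f => by simp [v]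
  let W : Submodule ℝ H := Submodule.span ℝ (Set.range v)
  have : FiniteDimensional ℝ W := FiniteDimensional.span_of_finite ℝ (Set.finite_range v)
  let ev : H →ₗ[ℝ] (Fin n → ℝ) := LinearMap.pi fun k => (innerSL ℝ (v k)).toLinearMap
  have hev : ∀ f k, ev f k = f (x k) := fun f k => hv k f
  -- The projection onto `W` depends only on the nodal values, so it factors through `ev`. Working
  -- on the range of `ev` and extending linearly avoids proving the kernel sections independent; the
  -- `ψ_k` are the images under `S` of the unit vectors.
  obtain ⟨r, hr⟩ := ev.rangeRestrict.exists_rightInverse_of_surjective ev.range_rangeRestrict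
  obtain ⟨S, hS⟩ := LinearMap.exists_extend (W.starProjection.toLinearMap.comp r)
  have hPS : ∀ f, S (ev f) = W.starProjection f := fun f => by
    have h1 : S (ev f) = W.starProjection (r (ev.rangeRestrict f)) :=
      LinearMap.congr_fun hS (ev.rangeRestrict f)
    rw [h1, ← sub_eq_zero, ← map_sub, Submodule.starProjection_apply_eq_zero_iff]
    have h2 : ev (r (ev.rangeRestrict f) - f) = 0 := by
      rw [map_sub, sub_eq_zero]
      exact congrArg Subtype.val (LinearMap.congr_fun hr (ev.rangeRestrict f))
    rw [Submodule.mem_orthogonal]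
    intro u hu
    induction hu using Submodule.span_induction with
    | mem u hu =>
      obtain ⟨k, rfl⟩ := hu
      rw [hv, ← hev, h2]; rfl
    | zero => simp
    | add u w _ _ hu hw => rw [inner_add_left, hu, hw, add_zero]
    | smul c u _ hu => rw [inner_smul_left, hu, mul_zero]
  refine ⟨⟨x, hx, fun k => S (Pi.single k 1), fun k =>
    (continuous_gaussianRKHS hε _).measurable.nullMeasurable⟩, rfl, fun f => ?_⟩
  refine ⟨f - W.starProjection f, ?_, ?_, fun k => ?_⟩
  · rw [RKHS.coe_sub, ← hPS]
    congr 1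
    ext y
    have h : ev f = ∑ k, f (x k) • (Pi.single k (1 : ℝ) : Fin n → ℝ) := by
      ext j
      simp [hev, Finset.sum_apply, Pi.single_apply]
    rw [h, map_sum]
    simp only [map_smul, LinearApprox.apply]
    rw [← RKHS.coeCLM_apply, map_sum, Finset.sum_apply]
    simp
  · have : f - W.starProjection f = Wᗮ.starProjection f := by
      rw [Submodule.starProjection_orthogonal_val]
    rw [this]
    exact Wᗮ.norm_starProjection_apply_le f
  · rw [← hv]
    exact (Submodule.sub_starProjection_mem_orthogonal f) _ (Submodule.subset_span ⟨k, rfl⟩)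

end

/-! ### Comparison of the zero-counting rate with the stated rate -/

section

/-- Here `e` stands for `ε` and `s` for `ε√n`; of the bracket in `cL` only `3` and `7/(16√λ)` are
kept. For `e ≤ 4/3` the correction `2e - 3e²/2` is nonnegative and `7/16` suffices; otherwise `3e >
4`, and `e² ≤ 9s/20` leaves an exponent of at least `13s/10`. -/
theorem sq_mul_le_exp {e s : ℝ} (he : 0 < e) (hs : 3 ≤ s) (hse : 5 * e ^ 4 ≤ s ^ 2) :
    2 * Real.exp 1 * √Real.pi * s ^ 2 ≤
      Real.exp (2 * s - 3 / 2 * e ^ 2 + 2 * e) * (7 / 16 + 3 * e) := by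
  have hc : 2 * Real.exp 1 * √Real.pi ≤ 9.65 := by
    have h1 := Real.exp_one_lt_d9
    have h2 : √Real.pi ≤ 1.775 := by
      rw [Real.sqrt_le_left (by norm_num)]
      linarith [Real.pi_lt_d2]
    have := mul_le_mul h1.le h2 (Real.sqrt_nonneg _) (by norm_num)
    linarith
  have hE3 : (20 : ℝ) ≤ Real.exp 3 := by
    have h : Real.exp 3 = Real.exp 1 ^ 3 := by rw [← Real.exp_nat_mul]; norm_num
    rw [h]
    calc (20 : ℝ) ≤ 2.718 ^ 3 := by norm_num
      _ ≤ _ := by gcongr; linarith [Real.exp_one_gt_d9]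
  refine (mul_le_mul_of_nonneg_right hc (sq_nonneg s)).trans ?_
  by_cases h : e ≤ 4 / 3
  · have h1 : Real.exp s ^ 2 ≤ Real.exp (2 * s - 3 / 2 * e ^ 2 + 2 * e) := by
      rw [← Real.exp_nat_mul]
      apply Real.exp_le_exp.mpr
      push_cast
      nlinarith
    have h2 : 20 * (s - 2) ≤ Real.exp s := by
      have h3 : Real.exp s = Real.exp 3 * Real.exp (s - 3) := by rw [← Real.exp_add]; ring_nf
      rw [h3]
      have := Real.add_one_le_exp (s - 3)
      exact mul_le_mul hE3 (by linarith) (by linarith) (by positivity)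
    have h3 : (5 * s) ^ 2 ≤ Real.exp s ^ 2 := by gcongr; linarith
    calc 9.65 * s ^ 2 ≤ (5 * s) ^ 2 * (7 / 16) := by nlinarith [sq_nonneg s]
      _ ≤ Real.exp (2 * s - 3 / 2 * e ^ 2 + 2 * e) * (7 / 16) := by gcongr; exact h3.trans h1
      _ ≤ _ := by gcongr; linarith
  · push Not at h
    have hes : e ^ 2 ≤ 9 / 20 * s := by
      refine le_of_sq_le_sq ?_ (by positivity)
      nlinarith
    have h1 : Real.exp (13 / 20 * s) ^ 2 ≤ Real.exp (2 * s - 3 / 2 * e ^ 2 + 2 * e) := by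
      rw [← Real.exp_nat_mul]
      apply Real.exp_le_exp.mpr
      push_cast
      linarith
    have h2 : 6 * (1 + 13 / 20 * (s - 3)) ≤ Real.exp (13 / 20 * s) := by
      have h3 : Real.exp (13 / 20 * s) = Real.exp (39 / 20) * Real.exp (13 / 20 * (s - 3)) := by
        rw [← Real.exp_add]; ring_nf
      rw [h3]
      have h4 := Real.add_one_le_exp (13 / 20 * (s - 3))
      have h5 : (6 : ℝ) ≤ Real.exp (39 / 20) := by
        refine le_of_pow_le_pow_left₀ (n := 20) (by norm_num) (by positivity) ?_
        rw [← Real.exp_nat_mul]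
        have h : Real.exp (((20 : ℕ) : ℝ) * (39 / 20)) = Real.exp 1 ^ 39 := by
          rw [← Real.exp_nat_mul]; norm_num
        rw [h]
        calc (6 : ℝ) ^ 20 ≤ 2.718 ^ 39 := by norm_num
          _ ≤ _ := by gcongr; linarith [Real.exp_one_gt_d9]
      exact mul_le_mul h5 (by linarith) (by linarith) (by positivity)
    have h3 : (8 / 5 * s) ^ 2 ≤ Real.exp (13 / 20 * s) ^ 2 := by gcongr; linarith
    calc 9.65 * s ^ 2 ≤ (8 / 5 * s) ^ 2 * 4 := by nlinarith [sq_nonneg s]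
      _ ≤ Real.exp (2 * s - 3 / 2 * e ^ 2 + 2 * e) * 4 := by gcongr; exact h3.trans h1
      _ ≤ _ := by gcongr; linarith

theorem le_of_mL_le {ε : ℝ} (hε : 0 < ε) {n : ℕ} (hn : mL (ε ^ 2) ≤ n) :
    5 * ε ^ 2 ≤ n ∧ 9 ≤ ε ^ 2 * n ∧ n ≠ 0 := by
  rw [mL, max_le_iff, max_le_iff, div_le_iff₀ (by positivity)] at hn
  obtain ⟨h1, -, h2⟩ := hn
  refine ⟨h1, by linarith, fun h => ?_⟩
  rw [h, Nat.cast_zero] at h1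
  nlinarith

/-- The left side is the squared loss from Stirling's formula; the exponential on the right beats
the remaining power of `n` because `ε√n ≥ 3`. -/
theorem exp_one_mul_sqrt_le {ε : ℝ} (hε : 0 < ε) {n : ℕ} (hn : mL (ε ^ 2) ≤ n) :
    Real.exp 1 * √n ≤ cL (ε ^ 2) * (n : ℝ) ^ (-(1 / 4) : ℝ) * Real.exp (2 * (ε * √n)) := by
  obtain ⟨h5, h9, hn0⟩ := le_of_mL_le hε hn
  have hnpos : (0 : ℝ) < n := by positivity
  set s := ε * √n with hs
  have hssq : s ^ 2 = ε ^ 2 * n := by rw [hs, mul_pow, Real.sq_sqrt hnpos.le]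
  have hs0 : 0 < s := by positivity
  have hs3 : 3 ≤ s := by
    refine le_of_sq_le_sq ?_ hs0.le
    linarith
  have key := sq_mul_le_exp hε hs3 (by rw [hssq]; nlinarith [sq_nonneg ε])
  have hquart : ((ε ^ 2) ^ (1 / 4 : ℝ) : ℝ) = √ε := by
    rw [← Real.rpow_natCast, ← Real.rpow_mul hε.le, Real.sqrt_eq_rpow]; norm_num
  have hquart' : (n : ℝ) ^ (-(1 / 4) : ℝ) = (√√(n : ℝ))⁻¹ := by
    rw [Real.rpow_neg hnpos.le, Real.sqrt_eq_rpow, Real.sqrt_eq_rpow, ← Real.rpow_mul hnpos.le]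
    norm_num
  have hss : √ε * √√(n : ℝ) ≤ s := by
    rw [← Real.sqrt_mul hε.le, ← hs, Real.sqrt_le_left hs0.le]
    nlinarith
  rw [cL, hquart, hquart', Real.sqrt_sq hε.le]
  set B := 3 + √(Real.pi / Real.exp 1) + 2 / (√Real.pi * √ε) + 7 / (16 * ε) + ε * (2 + ε ^ 2)
    with hB
  have hεB : 7 / 16 + 3 * ε ≤ ε * B := by
    have : ε * B = 7 / 16 + 3 * ε +
        ε * (√(Real.pi / Real.exp 1) + 2 / (√Real.pi * √ε) + ε * (2 + ε ^ 2)) := by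
      rw [hB]; field_simp; ring
    rw [this]
    have : 0 ≤ ε * (√(Real.pi / Real.exp 1) + 2 / (√Real.pi * √ε) + ε * (2 + ε ^ 2)) := by
      positivity
    linarith
  have hexp : Real.exp (-(3 / 2) * ε ^ 2 + 2 * ε) * Real.exp (2 * s) =
      Real.exp (2 * s - 3 / 2 * ε ^ 2 + 2 * ε) := by rw [← Real.exp_add]; ring_nf
  have hrw : Real.exp (-(3 / 2) * ε ^ 2 + 2 * ε) / (2 * √Real.pi * √ε) * B * (√√(n : ℝ))⁻¹ *
      Real.exp (2 * s) = Real.exp (2 * s - 3 / 2 * ε ^ 2 + 2 * ε) * B /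
        (2 * √Real.pi * (√ε * √√(n : ℝ))) := by
    rw [← hexp]; field_simp
  rw [hrw, le_div_iff₀ (by positivity)]
  refine le_of_mul_le_mul_left ?_ hε
  calc ε * (Real.exp 1 * √n * (2 * √Real.pi * (√ε * √√(n : ℝ))))
      = 2 * Real.exp 1 * √Real.pi * (s * (√ε * √√(n : ℝ))) := by rw [hs]; ring
    _ ≤ 2 * Real.exp 1 * √Real.pi * (s * s) := by gcongr
    _ = 2 * Real.exp 1 * √Real.pi * s ^ 2 := by ring
    _ ≤ _ := key
    _ ≤ Real.exp (2 * s - 3 / 2 * ε ^ 2 + 2 * ε) * (ε * B) := by gcongr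
    _ = _ := by ring

/-- Stirling's sequence `n!/(√(2n)(n/e)^n)` decreases from its value `e/√2` at `n = 1`. -/
theorem factorial_le_exp_one_mul_sqrt {n : ℕ} (hn : n ≠ 0) :
    (n ! : ℝ) ≤ Real.exp 1 * √n * (n / Real.exp 1) ^ n := by
  obtain ⟨m, rfl⟩ := Nat.exists_eq_succ_of_ne_zero hn
  have h := Stirling.stirlingSeq'_antitone (Nat.zero_le m)
  simp only [Function.comp, Nat.succ_eq_add_one, zero_add, Stirling.stirlingSeq_one] at h
  rw [Stirling.stirlingSeq, div_le_iff₀ (by positivity), Real.sqrt_mul (by norm_num)] at h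
  refine h.trans_eq ?_
  field_simp

/-- The common factor of the upper error bounds. -/
def upperRate (ε : ℝ) (n : ℕ) : ℝ :=
  √(cL (ε ^ 2)) * (n : ℝ) ^ (-(1 / 8) : ℝ) * Real.exp (ε * √n) * ε ^ n *
    (n ! : ℝ) ^ (-(1 / 2) : ℝ)

theorem cL_nonneg (l : ℝ) (hl : 0 < l) : 0 ≤ cL l := by unfold cL; positivity

theorem pow_mul_exp_le_upperRate {ε : ℝ} (hε : 0 < ε) {n : ℕ} (hn : mL (ε ^ 2) ≤ n) :
    (ε / √n) ^ n * Real.exp (n / 2) ≤ upperRate ε n := by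
  obtain ⟨-, -, hn0⟩ := le_of_mL_le hε hn
  have hnpos : (0 : ℝ) < n := by positivity
  have hc := cL_nonneg (ε ^ 2) (by positivity)
  have h0 : 0 ≤ upperRate ε n := by unfold upperRate; positivity
  refine le_of_sq_le_sq ?_ h0
  have hf0 : (0 : ℝ) < n ! := by positivity
  have hL : ((ε / √n) ^ n * Real.exp (n / 2)) ^ 2 = ε ^ (2 * n) / (n / Real.exp 1) ^ n := by
    rw [mul_pow, ← pow_mul, mul_comm n 2, pow_mul, div_pow, Real.sq_sqrt hnpos.le, div_pow,
      ← Real.exp_nat_mul (n / 2), div_pow, ← Real.exp_nat_mul, ← pow_mul]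
    have : ((2 : ℕ) : ℝ) * ((n : ℝ) / 2) = n * 1 := by push_cast; ring
    rw [this]
    field_simp
  have hU : upperRate ε n ^ 2 = cL (ε ^ 2) * (n : ℝ) ^ (-(1 / 4) : ℝ) *
      Real.exp (2 * (ε * √n)) * (ε ^ (2 * n) / n !) := by
    rw [upperRate, mul_pow, mul_pow, mul_pow, mul_pow, Real.sq_sqrt hc, ← Real.exp_nat_mul,
      ← Real.rpow_mul_natCast hnpos.le, ← Real.rpow_mul_natCast hf0.le, ← pow_mul, mul_comm n 2]
    have h1 : (n ! : ℝ) ^ (-(1 / 2) * ((2 : ℕ) : ℝ)) = (n ! : ℝ)⁻¹ := by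
      rw [← Real.rpow_neg_one]; norm_num
    rw [h1]
    norm_num
    ring
  rw [hL, hU]
  calc ε ^ (2 * n) / (n / Real.exp 1) ^ n ≤ Real.exp 1 * √n * (ε ^ (2 * n) / n !) := by
        rw [div_le_iff₀ (by positivity), mul_assoc, div_mul_eq_mul_div, mul_div_assoc',
          le_div_iff₀ hf0]
        calc ε ^ (2 * n) * n ! ≤ ε ^ (2 * n) * (Real.exp 1 * √n * (n / Real.exp 1) ^ n) := by
              gcongr; exact factorial_le_exp_one_mul_sqrt hn0
          _ = _ := by ring
    _ ≤ _ := by exact mul_le_mul_of_nonneg_right (exp_one_mul_sqrt_le hε hn) (by positivity)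

end

/-! ### Upper error bounds in both norms -/

section

open MeasureTheory

theorem lintegral_lebesgue_ofReal {F : ℝ → ℝ} (hF : Continuous F) (h0 : ∀ x, 0 ≤ F x) :
    ∫⁻ x : I, ENNReal.ofReal (F x) ∂lebesgue = ENNReal.ofReal (∫ x in (-1 : ℝ)..1, F x) := by
  rw [lebesgue, lintegral_subtype_comap measurableSet_Icc (fun x => ENNReal.ofReal (F x)),
    intervalIntegral.integral_of_le (by norm_num), ← integral_Icc_eq_integral_Ioc,
    ofReal_integral_eq_lintegral_ofReal]
  · exact hF.integrableOn_Icc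
  · exact Filter.Eventually.of_forall h0

theorem pNorm_top_le {h : I → ℝ} {C : ℝ} (hC : ∀ x, |h x| ≤ C) :
    pNorm ∞ h ≤ ENNReal.ofReal C := by
  rw [pNorm, if_pos rfl]
  refine iSup_le fun x => ?_
  rw [Real.enorm_eq_ofReal_abs]
  exact ENNReal.ofReal_le_ofReal (hC x)

theorem pNorm_two (h : I → ℝ) :
    pNorm 2 h = (∫⁻ x, ENNReal.ofReal (h x ^ 2) ∂lebesgue) ^ (1 / 2 : ℝ) := by
  rw [pNorm, if_neg (by norm_num)]
  norm_num
  congr 2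
  ext x
  rw [Real.enorm_eq_ofReal_abs, ← ENNReal.ofReal_pow (abs_nonneg _), sq_abs]

theorem pNorm_two_le {h : I → ℝ} {F : ℝ → ℝ} (hF : Continuous F) (h0 : ∀ x, 0 ≤ F x)
    (hh : ∀ x : I, h x ^ 2 ≤ F x) :
    pNorm 2 h ≤ ENNReal.ofReal √(∫ x in (-1 : ℝ)..1, F x) := by
  rw [pNorm_two, Real.sqrt_eq_rpow, ← ENNReal.ofReal_rpow_of_nonneg
    (intervalIntegral.integral_nonneg (by norm_num) fun x _ => h0 x) (by norm_num),
    ← lintegral_lebesgue_ofReal hF h0]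
  gcongr with x
  exact hh x

theorem le_pNorm_two {h : I → ℝ} {F : ℝ → ℝ} (hF : Continuous F) (h0 : ∀ x, 0 ≤ F x)
    (hh : ∀ x : I, F x ≤ h x ^ 2) :
    ENNReal.ofReal √(∫ x in (-1 : ℝ)..1, F x) ≤ pNorm 2 h := by
  rw [pNorm_two, Real.sqrt_eq_rpow, ← ENNReal.ofReal_rpow_of_nonneg
    (intervalIntegral.integral_nonneg (by norm_num) fun x _ => h0 x) (by norm_num),
    ← lintegral_lebesgue_ofReal hF h0]
  gcongr with x
  exact hh x

theorem worstCaseError_le {ε : ℝ} {p : ℝ≥0∞} {n : ℕ} {A : LinearApprox n} {C : ℝ}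
    (hC : ∀ f : GaussianRKHS ε, pNorm p (⇑f - A.apply ⇑f) ≤ ENNReal.ofReal (C * ‖f‖)) :
    worstCaseError ε p A ≤ ENNReal.ofReal C := by
  refine iSup₂_le fun f _ => ENNReal.div_le_of_le_mul ((hC f).trans_eq ?_)
  rw [ENNReal.ofReal_mul' (norm_nonneg f), ofReal_norm]

theorem upperRate_nonneg {ε : ℝ} (hε : 0 < ε) (n : ℕ) : 0 ≤ upperRate ε n := by
  unfold upperRate; positivity

/-- This pointwise estimate carries all upper bounds: the nodes enter only through the nodal
polynomial, and the same `A` serves both norms. -/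
theorem exists_linearApprox_abs_sub_le {ε : ℝ} (hε : 0 < ε) {n : ℕ} (hn : mL (ε ^ 2) ≤ n)
    {x : Fin n → I} (hx : Function.Injective x) :
    ∃ A : LinearApprox n, A.point = x ∧ ∀ (f : GaussianRKHS ε) (y : I),
      |(⇑f - A.apply ⇑f) y| ≤ (∏ k, |(y : ℝ) - x k|) * upperRate ε n * ‖f‖ := by
  obtain ⟨A, hA, h⟩ := exists_linearApprox_interpolating hε x hx
  refine ⟨A, hA, fun f y => ?_⟩
  obtain ⟨g, hg, hgf, hgx⟩ := h f
  rw [← hg]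
  refine (abs_le_of_vanish hε (le_of_mL_le hε hn).2.2 hx g hgx y).trans ?_
  have h0 : 0 ≤ ∏ k, |(y : ℝ) - x k| := Finset.prod_nonneg fun _ _ => abs_nonneg _
  exact mul_le_mul (mul_le_mul_of_nonneg_left (pow_mul_exp_le_upperRate hε hn) h0) hgf
    (norm_nonneg _) (mul_nonneg h0 (upperRate_nonneg hε n))

/-- Upper error bounds when the nodal polynomial is bounded by `c`. -/
theorem exists_linearApprox_of_prod_le {ε : ℝ} (hε : 0 < ε) {n : ℕ} (hn : mL (ε ^ 2) ≤ n)
    {x : Fin n → I} (hx : Function.Injective x) {c : ℝ} (hc : 0 ≤ c)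
    (hxc : ∀ y : I, ∏ k, |(y : ℝ) - x k| ≤ c) :
    ∃ A : LinearApprox n, A.point = x ∧
      worstCaseError ε ∞ A ≤ ENNReal.ofReal (c * upperRate ε n) ∧
      worstCaseError ε 2 A ≤ ENNReal.ofReal (√2 * (c * upperRate ε n)) := by
  obtain ⟨A, hA, h⟩ := exists_linearApprox_abs_sub_le hε hn hx
  have hU := upperRate_nonneg hε n
  have h' : ∀ (f : GaussianRKHS ε) (y : I), |(⇑f - A.apply ⇑f) y| ≤ c * upperRate ε n * ‖f‖ :=
    fun f y => (h f y).trans (by gcongr; exact hxc y)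
  refine ⟨A, hA, worstCaseError_le fun f => pNorm_top_le (h' f), worstCaseError_le fun f => ?_⟩
  refine (pNorm_two_le (F := fun _ => (c * upperRate ε n * ‖f‖) ^ 2) continuous_const
    (fun _ => sq_nonneg _) fun y => ?_).trans_eq ?_
  · rw [← sq_abs]
    gcongr
    exact h' f y
  · rw [intervalIntegral.integral_const, smul_eq_mul, Real.sqrt_mul (by norm_num),
      Real.sqrt_sq (by positivity)]
    congr 1
    rw [show (1 : ℝ) - -1 = 2 by norm_num]
    ring

/-- Upper error bounds for arbitrary sampling points. -/
theorem exists_linearApprox_of_injective {ε : ℝ} (hε : 0 < ε) {n : ℕ} (hn : mL (ε ^ 2) ≤ n)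
    {x : Fin n → I} (hx : Function.Injective x) :
    ∃ A : LinearApprox n, A.point = x ∧
      worstCaseError ε ∞ A ≤ ENNReal.ofReal (2 ^ n * upperRate ε n) ∧
      worstCaseError ε 2 A ≤ ENNReal.ofReal (√(2 / n) * (2 ^ n * upperRate ε n)) := by
  obtain ⟨A, hA, h⟩ := exists_linearApprox_abs_sub_le hε hn hx
  have hU := upperRate_nonneg hε n
  have hn0 : (0 : ℝ) < n := by
    have := (le_of_mL_le hε hn).2.2
    positivity
  have hprod : ∀ y : I, ∏ k, |(y : ℝ) - x k| ≤ (1 + |(y : ℝ)|) ^ n := fun y => by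
    refine (Finset.prod_le_prod (g := fun _ => 1 + |(y : ℝ)|) (fun _ _ => abs_nonneg _)
      fun k _ => ?_).trans_eq (by simp)
    have h1 := abs_sub (y : ℝ) (x k)
    have h2 : |(x k : ℝ)| ≤ 1 := abs_le.mpr (x k).2
    linarith
  refine ⟨A, hA, worstCaseError_le fun f => pNorm_top_le fun y => (h f y).trans ?_,
    worstCaseError_le fun f => ?_⟩
  · gcongr
    refine (hprod y).trans ?_
    have h2 : |(y : ℝ)| ≤ 1 := abs_le.mpr y.2
    gcongr
    linarith
  -- The sum of two powers is a polynomial majorant of `(1+|y|)^{2n}`; its integral is at most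
  -- `(2/n) 4^n`, the source of the gain `n^{-1/2}` for `p = 2`.
  · have hint : ∫ y in (-1 : ℝ)..1, ((1 + y) ^ (2 * n) + (1 - y) ^ (2 * n)) *
        (upperRate ε n * ‖f‖) ^ 2 =
        4 * 4 ^ n / (2 * n + 1) * (upperRate ε n * ‖f‖) ^ 2 := by
      rw [intervalIntegral.integral_mul_const, intervalIntegral.integral_add
        (Continuous.intervalIntegrable (by fun_prop) _ _)
        (Continuous.intervalIntegrable (by fun_prop) _ _),
        intervalIntegral.integral_comp_add_left (fun y => y ^ (2 * n)),
        intervalIntegral.integral_comp_sub_left (fun y => y ^ (2 * n)), integral_pow]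
      norm_num
      rw [pow_succ, pow_mul]
      left
      ring
    refine (pNorm_two_le (F := fun y => ((1 + y) ^ (2 * n) + (1 - y) ^ (2 * n)) *
      (upperRate ε n * ‖f‖) ^ 2) (by fun_prop) (fun y => ?_) fun y => ?_).trans ?_
    · have h1 := (even_two_mul n).pow_nonneg (1 + y)
      have h2 := (even_two_mul n).pow_nonneg (1 - y)
      positivity
    · have h1 := (even_two_mul n).pow_nonneg (1 + (y : ℝ))
      have h2 := (even_two_mul n).pow_nonneg (1 - (y : ℝ))
      have h3 : (1 + |(y : ℝ)|) ^ (2 * n) ≤ (1 + (y : ℝ)) ^ (2 * n) + (1 - (y : ℝ)) ^ (2 * n) := by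
        rcases abs_cases (y : ℝ) with ⟨h, -⟩ | ⟨h, -⟩ <;> rw [h]
        · linarith
        · rw [← sub_eq_add_neg]; linarith
      rw [← sq_abs]
      calc _ ≤ ((1 + |(y : ℝ)|) ^ n * upperRate ε n * ‖f‖) ^ 2 := by
            gcongr; exact (h f y).trans (by gcongr; exact hprod y)
        _ = (1 + |(y : ℝ)|) ^ (2 * n) * (upperRate ε n * ‖f‖) ^ 2 := by ring
        _ ≤ _ := by gcongr
    · rw [hint]
      apply ENNReal.ofReal_le_ofReal
      rw [Real.sqrt_le_left (by positivity)]
      calc 4 * 4 ^ n / (2 * n + 1) * (upperRate ε n * ‖f‖) ^ 2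
          ≤ (2 / n * 4 ^ n) * (upperRate ε n * ‖f‖) ^ 2 := by
            gcongr
            rw [div_le_iff₀ (by positivity)]
            have : 2 / (n : ℝ) * 4 ^ n * (2 * n + 1) = 4 * 4 ^ n + 2 / n * 4 ^ n := by
              field_simp; ring
            rw [this]
            have : 0 ≤ 2 / (n : ℝ) * 4 ^ n := by positivity
            linarith
        _ = _ := by
            have : (4 : ℝ) ^ n = (2 ^ n) ^ 2 := by rw [← pow_mul, mul_comm, pow_mul]; norm_num
            rw [mul_pow, mul_pow, mul_pow, Real.sq_sqrt (by positivity), mul_pow, this]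
            ring

open Polynomial in
/-- The nodal polynomial of the Chebyshev nodes. -/
theorem exists_chebyshev_nodes {n : ℕ} (hn : n ≠ 0) :
    ∃ x : Fin n → I, Function.Injective x ∧ ∀ y : I, ∏ k, |(y : ℝ) - x k| ≤ 2 * (1 / 2) ^ n := by
  set c : ℕ → ℝ := fun k => Real.cos ((2 * k + 1) * Real.pi / (2 * n)) with hc
  have hinj : Set.InjOn c (Finset.range n) :=
    (Finset.range n).nodup_map_iff_injOn.mp (Chebyshev.roots_T_real_nodup n)
  refine ⟨fun k => ⟨c k, Real.neg_one_le_cos _, Real.cos_le_one _⟩, fun i j h => ?_, fun y => ?_⟩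
  · exact Fin.ext (hinj (by simp) (by simp) (congrArg Subtype.val h))
  · have hroots := Chebyshev.roots_T_real n
    -- `T_n` is `2^{n-1}` times the nodal polynomial, and `|T_n| ≤ 1` on `[-1,1]`.
    have hprod := C_leadingCoeff_mul_prod_multiset_X_sub_C (p := Chebyshev.T ℝ n) (by
      rw [hroots, Chebyshev.natDegree_T, Finset.card_val, Finset.card_image_of_injOn hinj]
      simp)
    rw [hroots, Chebyshev.leadingCoeff_T, ← Finset.prod_eq_multiset_prod,
      Finset.prod_image hinj] at hprod
    have hev := congrArg (fun q => |q.eval (y : ℝ)|) hprod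
    simp only [eval_mul, eval_C, eval_prod, eval_sub, eval_X, abs_mul, Finset.abs_prod,
      Int.natAbs_natCast] at hev
    rw [Finset.prod_range (fun k => |(y : ℝ) - Real.cos ((2 * k + 1) * Real.pi / (2 * n))|),
      abs_of_pos (by positivity)] at hev
    have hT := Chebyshev.abs_eval_T_real_le_one n (abs_le.mpr y.2)
    rw [← hev] at hT
    have h2 : (2 : ℝ) * (1 / 2) ^ n = 1 / 2 ^ (n - 1) := by
      obtain ⟨m, rfl⟩ := Nat.exists_eq_succ_of_ne_zero hn
      rw [one_div, inv_pow, Nat.succ_eq_add_one, Nat.add_sub_cancel, pow_succ]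
      field_simp
    rw [h2, le_div_iff₀ (by positivity), mul_comm]
    exact hT

end

section

open Polynomial

/-! ### Expansion in Chebyshev polynomials of the second kind -/

theorem integral_cos_int_mul {m : ℤ} (hm : m ≠ 0) :
    ∫ θ in (0 : ℝ)..Real.pi, Real.cos (m * θ) = 0 := by
  rw [intervalIntegral.integral_comp_mul_left _ (by exact_mod_cast hm), integral_cos]
  simp [Real.sin_int_mul_pi]

theorem integral_sin_mul_sin (j k : ℕ) :
    ∫ θ in (0 : ℝ)..Real.pi, Real.sin ((j + 1) * θ) * Real.sin ((k + 1) * θ) =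
      if j = k then Real.pi / 2 else 0 := by
  have h1 : ∀ θ : ℝ, Real.sin ((j + 1) * θ) * Real.sin ((k + 1) * θ) =
      1 / 2 * (Real.cos (((j - k : ℤ) : ℝ) * θ) - Real.cos (((j + k + 2 : ℤ) : ℝ) * θ)) := by
    intro θ
    have ha : ((j - k : ℤ) : ℝ) * θ = (j + 1) * θ - (k + 1) * θ := by push_cast; ring
    have hb : ((j + k + 2 : ℤ) : ℝ) * θ = (j + 1) * θ + (k + 1) * θ := by push_cast; ring
    rw [ha, hb, Real.cos_sub, Real.cos_add]
    ring
  simp only [h1]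
  rw [intervalIntegral.integral_const_mul, intervalIntegral.integral_sub
    (Continuous.intervalIntegrable (by fun_prop) _ _)
    (Continuous.intervalIntegrable (by fun_prop) _ _), integral_cos_int_mul (m := j + k + 2)
    (by omega)]
  split_ifs with h
  · subst h
    simp
    ring
  · rw [integral_cos_int_mul (by omega)]
    simp

theorem coeff_self_chebyshevU (k : ℕ) : (Chebyshev.U ℝ k).coeff k = 2 ^ k := by
  have := Chebyshev.leadingCoeff_U_natCast ℝ k
  rwa [leadingCoeff, Chebyshev.natDegree_U_natCast] at this

theorem exists_eq_sum_chebyshevU (n : ℕ) :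
    ∀ p : ℝ[X], p.natDegree ≤ n →
      ∃ b : ℕ → ℝ, p = ∑ k ∈ Finset.range (n + 1), C (b k) * Chebyshev.U ℝ k := by
  induction n with
  | zero =>
    intro p hp
    refine ⟨fun _ => p.coeff 0, ?_⟩
    simpa using eq_C_of_natDegree_le_zero hp
  | succ n ih =>
    intro p hp
    set c := p.coeff (n + 1) / 2 ^ (n + 1) with hc
    obtain ⟨b, hb⟩ := ih (p - C c * Chebyshev.U ℝ (n + 1 : ℕ)) (by
      rw [natDegree_le_iff_coeff_eq_zero]
      intro N hN
      rw [coeff_sub, coeff_C_mul]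
      rcases (Nat.succ_le_of_lt hN).eq_or_lt with h | h
      · rw [← h, Nat.succ_eq_add_one, coeff_self_chebyshevU, hc]
        field_simp
        ring
      · rw [coeff_eq_zero_of_natDegree_lt (hp.trans_lt h), coeff_eq_zero_of_natDegree_lt
          (by rw [Chebyshev.natDegree_U_natCast]; exact h)]
        ring)
    refine ⟨fun k => if k = n + 1 then c else b k, ?_⟩
    rw [Finset.sum_range_succ]
    simp only [if_pos]
    rw [← sub_eq_iff_eq_add, hb]
    refine Finset.sum_congr rfl fun k hk => ?_
    rw [if_neg (Finset.mem_range.mp hk).ne]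

/-- Parseval: `U_k(cos θ) sin θ = sin((k+1)θ)`, and these sines are orthogonal on `[0,π]`. -/
theorem integral_sq_sum_chebyshevU (s : Finset ℕ) (b : ℕ → ℝ) :
    ∫ θ in (0 : ℝ)..Real.pi,
      ((∑ k ∈ s, C (b k) * Chebyshev.U ℝ k).eval (Real.cos θ) * Real.sin θ) ^ 2 =
      Real.pi / 2 * ∑ k ∈ s, b k ^ 2 := by
  have h1 : ∀ θ : ℝ,
      ((∑ k ∈ s, C (b k) * Chebyshev.U ℝ k).eval (Real.cos θ) * Real.sin θ) ^ 2 =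
      ∑ j ∈ s, ∑ k ∈ s, b j * b k * (Real.sin ((j + 1) * θ) * Real.sin ((k + 1) * θ)) := by
    intro θ
    rw [eval_finsetSum, Finset.sum_mul, sq, Finset.sum_mul_sum]
    refine Finset.sum_congr rfl fun j _ => Finset.sum_congr rfl fun k _ => ?_
    have hj := Chebyshev.U_real_cos θ j
    have hk := Chebyshev.U_real_cos θ k
    push_cast at hj hk
    rw [← hj, ← hk]
    simp only [eval_mul, eval_C]
    ring
  simp only [h1]
  rw [intervalIntegral.integral_finsetSum fun j _ =>
    Continuous.intervalIntegrable (by fun_prop) _ _, Finset.mul_sum]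
  refine Finset.sum_congr rfl fun j hj => ?_
  rw [intervalIntegral.integral_finsetSum fun j _ =>
    Continuous.intervalIntegrable (by fun_prop) _ _]
  simp only [intervalIntegral.integral_const_mul, integral_sin_mul_sin]
  simp [hj]
  ring

theorem integral_sq_eval_cos_mul_sin_le_of_abs_le {p : ℝ[X]} {M : ℝ}
    (hM : ∀ x ∈ Set.Icc (-1 : ℝ) 1, |p.eval x| ≤ M) :
    ∫ θ in (0 : ℝ)..Real.pi, (p.eval (Real.cos θ) * Real.sin θ) ^ 2 ≤ Real.pi / 2 * M ^ 2 := by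
  have h : ∫ θ in (0 : ℝ)..Real.pi, M ^ 2 * Real.sin θ ^ 2 = Real.pi / 2 * M ^ 2 := by
    rw [intervalIntegral.integral_const_mul, integral_sin_sq]
    simp
    ring
  rw [← h]
  refine intervalIntegral.integral_mono_on Real.pi_pos.le
    (Continuous.intervalIntegrable (by fun_prop) _ _)
    (Continuous.intervalIntegrable (by fun_prop) _ _) fun θ _ => ?_
  rw [mul_pow, ← sq_abs (p.eval _)]
  gcongr
  exact hM _ (Real.cos_mem_Icc θ)

/-- Substituting `x = cos θ` produces one factor `sin θ`, and `sin² θ ≤ sin θ` on `[0,π]`. -/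
theorem integral_sq_eval_cos_mul_sin_le (p : ℝ[X]) :
    ∫ θ in (0 : ℝ)..Real.pi, (p.eval (Real.cos θ) * Real.sin θ) ^ 2 ≤
      ∫ x in (-1 : ℝ)..1, p.eval x ^ 2 := by
  have h := intervalIntegral.integral_comp_mul_deriv (a := 0) (b := Real.pi)
    (f := Real.cos) (f' := fun θ => -Real.sin θ) (g := fun x => p.eval x ^ 2)
    (fun θ _ => Real.hasDerivAt_cos θ) (by fun_prop) (by fun_prop)
  rw [Real.cos_zero, Real.cos_pi, intervalIntegral.integral_symm (-1) 1] at h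
  rw [← neg_eq_iff_eq_neg.mpr h, ← intervalIntegral.integral_neg]
  refine intervalIntegral.integral_mono_on Real.pi_pos.le
    (Continuous.intervalIntegrable (by fun_prop) _ _)
    (Continuous.intervalIntegrable (by fun_prop) _ _) fun θ hθ => ?_
  have h0 := Real.sin_nonneg_of_nonneg_of_le_pi hθ.1 hθ.2
  have h1 := Real.sin_le_one θ
  simp only [Function.comp]
  nlinarith [mul_nonneg (sq_nonneg (p.eval (Real.cos θ))) (mul_nonneg h0 (sub_nonneg.mpr h1))]

/-! ### Coefficients of the Chebyshev polynomials of the second kind -/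

theorem coeff_chebyshevU_add_two (k j : ℕ) :
    (Chebyshev.U ℝ (k + 2 : ℕ)).coeff (j + 1) =
      2 * (Chebyshev.U ℝ (k + 1 : ℕ)).coeff j - (Chebyshev.U ℝ k).coeff (j + 1) := by
  have h := Chebyshev.U_add_two ℝ k
  push_cast
  rw [h, coeff_sub, mul_assoc, ← C_ofNat, coeff_C_mul, coeff_X_mul]

theorem coeff_zero_chebyshevU_add_two (k : ℕ) :
    (Chebyshev.U ℝ (k + 2 : ℕ)).coeff 0 = - (Chebyshev.U ℝ k).coeff 0 := by
  have h := Chebyshev.U_add_two ℝ k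
  push_cast
  rw [h, coeff_sub, mul_assoc, ← C_ofNat, coeff_C_mul, mul_coeff_zero, coeff_X_zero]
  ring

theorem coeff_chebyshevU_of_odd (k : ℕ) :
    ∀ j, Odd (k + j) → (Chebyshev.U ℝ k).coeff j = 0 := by
  induction k using Nat.twoStepInduction with
  | zero =>
    intro j hj
    have : j ≠ 0 := by rintro rfl; simp at hj
    simp [coeff_one, this]
  | one =>
    intro j hj
    have : j ≠ 1 := by rintro rfl; simp [Nat.odd_iff] at hj
    have h2 : (2 : ℝ[X]) = C 2 := rfl
    simp [h2, coeff_X, this.symm]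
  | more k ih1 ih2 =>
    intro j hj
    rw [Nat.odd_iff] at hj
    cases j with
    | zero =>
      rw [coeff_zero_chebyshevU_add_two, ih1 0 (Nat.odd_iff.mpr (by omega)), neg_zero]
    | succ j =>
      rw [coeff_chebyshevU_add_two, ih2 j (Nat.odd_iff.mpr (by omega)),
        ih1 (j + 1) (Nat.odd_iff.mpr (by omega))]
      ring

/-- In the recurrence `U_{k+2} = 2X U_{k+1} - U_k` the absolute values add up by Pascal's rule. -/
theorem abs_coeff_chebyshevU_le (k : ℕ) :
    ∀ j m, k = j + 2 * m → |(Chebyshev.U ℝ k).coeff j| ≤ 2 ^ j * (j + m).choose m := by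
  induction k using Nat.twoStepInduction with
  | zero =>
    intro j m h
    obtain rfl : j = 0 := by omega
    obtain rfl : m = 0 := by omega
    simp
  | one =>
    intro j m h
    obtain rfl : m = 0 := by omega
    obtain rfl : j = 1 := by omega
    have h2 : (2 : ℝ[X]) = C 2 := rfl
    simp [h2]
  | more k ih1 ih2 =>
    intro j m h
    cases j with
    | zero =>
      rw [coeff_zero_chebyshevU_add_two, abs_neg]
      have := ih1 0 (m - 1) (by omega)
      simpa using this
    | succ j =>
      rw [coeff_chebyshevU_add_two]
      have h1 := ih2 j m (by omega)
      -- Writing the binomial as a Pascal difference also covers `m = 0`, where `j + 1` exceeds the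
      -- degree and the difference is zero.
      have h2 : |(Chebyshev.U ℝ k).coeff (j + 1)| ≤
          2 ^ (j + 1) * (((j + 1 + m).choose m : ℝ) - (j + m).choose m) := by
        cases m with
        | zero =>
          rw [coeff_eq_zero_of_natDegree_lt (by rw [Chebyshev.natDegree_U_natCast]; omega)]
          simp
        | succ m =>
          refine (ih1 (j + 1) m (by omega)).trans_eq ?_
          have : j + 1 + (m + 1) = (j + 1 + m) + 1 := by ring
          rw [this, Nat.choose_succ_succ, show j + (m + 1) = j + 1 + m by ring]
          push_cast
          ring
      refine (abs_sub _ _).trans ?_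
      rw [abs_mul, abs_two]
      calc _ ≤ 2 * (2 ^ j * ((j + m).choose m : ℝ)) +
            2 ^ (j + 1) * (((j + 1 + m).choose m : ℝ) - (j + m).choose m) := by gcongr
        _ = _ := by ring

theorem choose_sq_mul_factorial_le (j m : ℕ) :
    (j + m).choose m ^ 2 * j ! * m ! ^ 2 ≤ (j + 2 * m)! := by
  have h1 : (j + m).choose m * m ! * j ! = (j + m)! := by
    have := Nat.choose_mul_factorial_mul_factorial (Nat.le_add_left m j)
    rwa [Nat.add_sub_cancel] at this
  have h2 : (j + 2 * m).choose m * m ! * (j + m)! = (j + 2 * m)! := by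
    have := Nat.choose_mul_factorial_mul_factorial (show m ≤ j + 2 * m by omega)
    rwa [show j + 2 * m - m = j + m by omega] at this
  calc (j + m).choose m ^ 2 * j ! * m ! ^ 2
      = (j + m).choose m * m ! * ((j + m).choose m * m ! * j !) := by ring
    _ = (j + m).choose m * m ! * (j + m)! := by rw [h1]
    _ ≤ (j + 2 * m).choose m * m ! * (j + m)! := by
        gcongr; omega
    _ = _ := h2

/-- The squared norm of `x ↦ e^{-l x²/2} x^j` in `H(K)`, with `l = ε²`. -/
def monomialWeight (l : ℝ) (j : ℕ) : ℝ := j ! / l ^ j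

theorem monomialWeight_pos {l : ℝ} (hl : 0 < l) (j : ℕ) : 0 < monomialWeight l j := by
  unfold monomialWeight; positivity

/-- Lowering the degree by `2m` costs `(l/4)^{2m}`, while the factorials gain `m!²`. One `m!` is
enough to recognise a term of the series of `e^{l²/16}`. -/
theorem coeff_chebyshevU_sq_mul_le {l : ℝ} (hl : 0 < l) (j m : ℕ) :
    (Chebyshev.U ℝ (j + 2 * m : ℕ)).coeff j ^ 2 * monomialWeight l j ≤
      4 ^ (j + 2 * m) * monomialWeight l (j + 2 * m) * ((l ^ 2 / 16) ^ m / m !) := by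
  have h1 := abs_coeff_chebyshevU_le _ j m rfl
  have h2 : (((j + m).choose m : ℝ)) ^ 2 * j ! * m ! ^ 2 ≤ (j + 2 * m)! := by
    exact_mod_cast choose_sq_mul_factorial_le j m
  have h3 : (1 : ℝ) ≤ m ! := by exact_mod_cast Nat.one_le_iff_ne_zero.mpr m.factorial_ne_zero
  have hm : (0 : ℝ) < m ! := by positivity
  rw [← sq_abs]
  calc |(Chebyshev.U ℝ (j + 2 * m : ℕ)).coeff j| ^ 2 * monomialWeight l j
      ≤ (2 ^ j * ((j + m).choose m : ℝ)) ^ 2 * monomialWeight l j := by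
        have := (monomialWeight_pos hl j).le
        gcongr
    _ = 4 ^ j / l ^ j * (((j + m).choose m : ℝ) ^ 2 * j ! * m !) / m ! := by
        rw [monomialWeight, mul_pow, ← pow_mul, mul_comm j 2, pow_mul]
        field_simp
        norm_num
        ring
    _ ≤ 4 ^ j / l ^ j * (((j + m).choose m : ℝ) ^ 2 * j ! * m ! ^ 2) / m ! := by
        gcongr
        nlinarith
    _ ≤ 4 ^ j / l ^ j * (j + 2 * m)! / m ! := by gcongr
    _ = _ := by
        rw [monomialWeight, div_pow, pow_add, pow_add, pow_mul, pow_mul]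
        field_simp
        norm_num

theorem sum_coeff_chebyshevU_sq_le {l : ℝ} (hl : 0 < l) (k : ℕ) :
    ∑ j ∈ Finset.range k, (Chebyshev.U ℝ k).coeff j ^ 2 * monomialWeight l j ≤
      4 ^ k * monomialWeight l k * (Real.exp (l ^ 2 / 16) - 1) := by
  set G : ℕ → ℝ := fun m => 4 ^ k * monomialWeight l k * ((l ^ 2 / 16) ^ m / m !) with hG
  have hG0 : ∀ m, 0 ≤ G m := fun m => by
    have := (monomialWeight_pos hl k).le
    positivity
  -- By parity only `j = k - 2m` with `m ≥ 1` survive; the missing `m = 0` accounts for the `-1`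
  -- next to the exponential.
  set s := (Finset.range k).filter fun j => ¬ Odd (k + j)
  have hs : ∀ j ∈ s, j < k ∧ k = j + 2 * ((k - j) / 2) ∧ 0 < (k - j) / 2 := fun j hj => by
    obtain ⟨h1, h2⟩ := Finset.mem_filter.mp hj
    rw [Finset.mem_range] at h1
    rw [Nat.odd_iff] at h2
    omega
  have hinj : Set.InjOn (fun j => (k - j) / 2 - 1) (s : Set ℕ) := fun i hi j hj h => by
    have h1 := hs i hi
    have h2 := hs j hj
    simp only at h
    omega
  calc _ = ∑ j ∈ s, (Chebyshev.U ℝ k).coeff j ^ 2 * monomialWeight l j := by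
        refine (Finset.sum_subset (Finset.filter_subset _ _) fun j hj hjs => ?_).symm
        have : Odd (k + j) := by
          by_contra h
          exact hjs (Finset.mem_filter.mpr ⟨hj, h⟩)
        rw [coeff_chebyshevU_of_odd k j this]
        ring
    _ ≤ ∑ j ∈ s, G ((k - j) / 2 - 1 + 1) := by
        refine Finset.sum_le_sum fun j hj => ?_
        obtain ⟨h1, h2, h3⟩ := hs j hj
        rw [Nat.sub_add_cancel h3]
        have := coeff_chebyshevU_sq_mul_le hl j ((k - j) / 2)
        rwa [← h2] at this
    _ = ∑ m ∈ s.image fun j => (k - j) / 2 - 1, G (m + 1) := by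
        rw [Finset.sum_image hinj]
    _ ≤ ∑ m ∈ Finset.range k, G (m + 1) := by
        refine Finset.sum_le_sum_of_subset_of_nonneg (fun m hm => ?_) fun _ _ _ => hG0 _
        obtain ⟨j, hj, rfl⟩ := Finset.mem_image.mp hm
        have := hs j hj
        rw [Finset.mem_range]
        omega
    _ = 4 ^ k * monomialWeight l k *
          (∑ m ∈ Finset.range (k + 1), (l ^ 2 / 16) ^ m / (m ! : ℝ) - 1) := by
        rw [Finset.sum_range_succ', hG, ← Finset.mul_sum]
        simp
    _ ≤ _ := by
        have := (monomialWeight_pos hl k).le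
        gcongr
        exact Real.sum_le_exp_of_nonneg (by positivity) _

/-- The terms `q k` have ratio `4(k+1)/l`, so they first decrease and then increase and are at most
`max 1 (q k)` up to index `k`. As `5l ≤ n` forces `q (n-1) ≥ 1`, the sum is at most `n · q (n-1) =
(l/4) q n`. -/
theorem sum_pow_mul_monomialWeight_le {l : ℝ} (hl : 0 < l) {n : ℕ} (hn0 : n ≠ 0)
    (hn : 5 * l ≤ n) :
    ∑ k ∈ Finset.range n, 4 ^ k * monomialWeight l k ≤ l / 4 * (4 ^ n * monomialWeight l n) := by
  obtain ⟨m, rfl⟩ := Nat.exists_eq_succ_of_ne_zero hn0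
  set q : ℕ → ℝ := fun k => 4 ^ k * monomialWeight l k with hq
  have hq0 : ∀ k, 0 < q k := fun k => by
    have := monomialWeight_pos hl k
    positivity
  have hrec : ∀ k, q (k + 1) * (l / 4) = (k + 1) * q k := fun k => by
    simp only [hq, monomialWeight, Nat.factorial_succ]
    push_cast
    field_simp
    ring
  have hmax : ∀ k i, i ≤ k → q i ≤ max 1 (q k) := by
    intro k
    induction k with
    | zero => intro i hi; obtain rfl : i = 0 := by omega
              exact le_max_right _ _
    | succ k ih =>
      intro i hi
      rcases hi.eq_or_lt with rfl | hi
      · exact le_max_right _ _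
      have h1 : ∀ i ≤ k, ((k : ℝ) + 1 < l / 4) → q (i + 1) ≤ 1 := by
        intro i
        induction i with
        | zero =>
          intro _ h
          have := hrec 0
          have h0 : q 0 = 1 := by simp [hq, monomialWeight]
          rw [h0] at this
          push_cast at this
          have hk : (0 : ℝ) ≤ k := by positivity
          rw [zero_add]
          nlinarith [hq0 1]
        | succ i ih' =>
          intro hik h
          have h2 := ih' (by omega) h
          have h3 := hrec (i + 1)
          have hik' : ((i + 1 : ℕ) : ℝ) ≤ k := by exact_mod_cast hik
          have h4 : (((i + 1 : ℕ) : ℝ) + 1) * q (i + 1) ≤ l / 4 := by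
            nlinarith [hq0 (i + 1)]
          nlinarith [hq0 (i + 1 + 1)]
      by_cases h : (k : ℝ) + 1 < l / 4
      · refine le_max_of_le_left ?_
        cases i with
        | zero => simp [hq, monomialWeight]
        | succ i => exact h1 i (by omega) h
      · push Not at h
        refine (ih i (by omega)).trans (max_le_max_left 1 ?_)
        have h3 := hrec k
        have h5 : q k * (l / 4) ≤ q (k + 1) * (l / 4) := by
          rw [h3]; nlinarith [hq0 k]
        exact le_of_mul_le_mul_right h5 (by positivity)
  -- From `(m+1)^m/m! ≤ e^{m+1} ≤ e^{2m} ≤ 9^m` and `l ≤ (m+1)/5`, with `9/5 ≤ 4`.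
  have hone : 1 ≤ q m := by
    simp only [hq, monomialWeight]
    rcases Nat.eq_zero_or_pos m with rfl | hm
    · simp
    rw [mul_div_assoc', le_div_iff₀ (by positivity), one_mul]
    have h1 := Real.pow_div_factorial_le_exp (x := (m : ℝ) + 1) (by positivity) m
    have h2 : Real.exp ((m : ℝ) + 1) ≤ 9 ^ m := by
      have hm1 : (1 : ℝ) ≤ m := by exact_mod_cast hm
      calc Real.exp ((m : ℝ) + 1) ≤ Real.exp (m * 2) := Real.exp_le_exp.mpr (by linarith)
        _ = (Real.exp 1 ^ 2) ^ m := by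
          rw [← Real.exp_nat_mul, ← Real.exp_nat_mul]; norm_num
        _ ≤ 9 ^ m := by
          gcongr
          nlinarith [Real.exp_one_lt_d9, Real.exp_pos 1]
    rw [div_le_iff₀ (by positivity)] at h1
    push_cast at hn
    calc l ^ m ≤ (((m : ℝ) + 1) / 5) ^ m := by gcongr; linarith
      _ = ((m : ℝ) + 1) ^ m / 5 ^ m := by rw [div_pow]
      _ ≤ 9 ^ m * m ! / 5 ^ m := by gcongr; exact h1.trans (by gcongr)
      _ = (9 / 5) ^ m * m ! := by rw [div_pow]; ring
      _ ≤ 4 ^ m * m ! := by gcongr; norm_num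
  calc ∑ k ∈ Finset.range (m + 1), q k ≤ ∑ k ∈ Finset.range (m + 1), q m := by
        refine Finset.sum_le_sum fun k hk => ?_
        have := hmax m k (by simpa [Nat.lt_succ_iff] using hk)
        rwa [max_eq_right hone] at this
    _ = (m + 1) * q m := by simp
    _ = q (m + 1) * (l / 4) := (hrec m).symm
    _ = _ := mul_comm _ _

end

/-! ### Fooling functions and the lower error bound -/

section

open Polynomial

theorem coeff_sum_chebyshevU_sq_le (n : ℕ) (b : ℕ → ℝ) (j : ℕ) :
    (∑ k ∈ Finset.range (n + 1), C (b k) * Chebyshev.U ℝ k).coeff j ^ 2 ≤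
      (∑ k ∈ Finset.range (n + 1), b k ^ 2) *
        ∑ k ∈ Finset.range (n + 1), (Chebyshev.U ℝ k).coeff j ^ 2 := by
  simp only [finsetSum_coeff, coeff_C_mul]
  exact Finset.sum_mul_sq_le_sq_mul_sq _ _ _

theorem coeff_chebyshevU_of_lt {k j : ℕ} (h : k < j) : (Chebyshev.U ℝ k).coeff j = 0 :=
  coeff_eq_zero_of_natDegree_lt (by rwa [Chebyshev.natDegree_U_natCast])

/-- The leading coefficient and the weighted sum of the squares of the lower coefficients of a
polynomial are controlled by a weighted `L²` norm. -/
theorem coeff_sq_le_and_sum_coeff_sq_le {l : ℝ} (hl : 0 < l) {n : ℕ} (hn0 : n ≠ 0)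
    (hn : 5 * l ≤ n) {p : ℝ[X]} (hp : p.natDegree ≤ n) {B : ℝ}
    (hB : ∫ θ in (0 : ℝ)..Real.pi, (p.eval (Real.cos θ) * Real.sin θ) ^ 2 ≤ Real.pi / 2 * B) :
    p.coeff n ^ 2 ≤ B * 4 ^ n ∧
    ∑ j ∈ Finset.range n, p.coeff j ^ 2 * monomialWeight l j ≤
      B * (4 ^ n * monomialWeight l n) *
        (Real.exp (l ^ 2 / 16) - 1 + l / 4 * Real.exp (l ^ 2 / 16)) := by
  obtain ⟨b, rfl⟩ := exists_eq_sum_chebyshevU n p hp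
  rw [integral_sq_sum_chebyshevU] at hB
  replace hB := le_of_mul_le_mul_left hB (by positivity)
  have hw := fun j => (monomialWeight_pos hl j).le
  have hE : 0 ≤ Real.exp (l ^ 2 / 16) - 1 := by
    have := Real.one_le_exp (show 0 ≤ l ^ 2 / 16 by positivity)
    linarith
  constructor
  · refine (coeff_sum_chebyshevU_sq_le n b n).trans ?_
    rw [Finset.sum_range_succ (fun k => (Chebyshev.U ℝ k).coeff n ^ 2),
      Finset.sum_eq_zero (s := Finset.range n) (f := fun k => (Chebyshev.U ℝ k).coeff n ^ 2)
        fun k hk => by rw [coeff_chebyshevU_of_lt (Finset.mem_range.mp hk)]; ring,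
      zero_add, coeff_self_chebyshevU, ← pow_mul, mul_comm n 2, pow_mul]
    norm_num
    exact hB
  · have hrow : ∀ k ∈ Finset.range n,
        ∑ j ∈ Finset.range n, (Chebyshev.U ℝ k).coeff j ^ 2 * monomialWeight l j ≤
          4 ^ k * monomialWeight l k * Real.exp (l ^ 2 / 16) := fun k hk => by
      rw [← Finset.sum_subset (Finset.range_subset_range.mpr (Finset.mem_range.mp hk))
        fun j _ hj => by
          rw [coeff_chebyshevU_of_lt (by simpa [Nat.lt_succ_iff] using hj)]; ring,
        Finset.sum_range_succ, coeff_self_chebyshevU, ← pow_mul, mul_comm k 2, pow_mul]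
      have := sum_coeff_chebyshevU_sq_le hl k
      norm_num
      linarith
    calc _ ≤ ∑ j ∈ Finset.range n, (B * ∑ k ∈ Finset.range (n + 1),
          (Chebyshev.U ℝ k).coeff j ^ 2) * monomialWeight l j := by
          refine Finset.sum_le_sum fun j _ => mul_le_mul_of_nonneg_right
            ((coeff_sum_chebyshevU_sq_le n b j).trans ?_) (hw j)
          gcongr
      _ = B * ∑ k ∈ Finset.range (n + 1), ∑ j ∈ Finset.range n,
          (Chebyshev.U ℝ k).coeff j ^ 2 * monomialWeight l j := by
          rw [Finset.sum_comm, Finset.mul_sum]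
          refine Finset.sum_congr rfl fun j _ => ?_
          rw [← Finset.sum_mul, mul_assoc]
      -- Rows `k < n` include their diagonal entry; row `n` omits it because `j < n`, so it
      -- contributes only the exponential minus one.
      _ ≤ B * (∑ k ∈ Finset.range n, 4 ^ k * monomialWeight l k * Real.exp (l ^ 2 / 16) +
          4 ^ n * monomialWeight l n * (Real.exp (l ^ 2 / 16) - 1)) := by
          have hB0 : 0 ≤ B := (Finset.sum_nonneg fun _ _ => sq_nonneg _).trans hB
          rw [Finset.sum_range_succ]
          gcongr with k hk
          · exact hrow k hk
          · exact sum_coeff_chebyshevU_sq_le hl n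
      _ ≤ B * (l / 4 * (4 ^ n * monomialWeight l n) * Real.exp (l ^ 2 / 16) +
          4 ^ n * monomialWeight l n * (Real.exp (l ^ 2 / 16) - 1)) := by
          have hB0 : 0 ≤ B := (Finset.sum_nonneg fun _ _ => sq_nonneg _).trans hB
          rw [← Finset.sum_mul]
          gcongr
          exact sum_pow_mul_monomialWeight_le hl hn0 hn
      _ = _ := by ring

open InnerProductSpace in
/-- Polynomials times the Gaussian factor `e^{-ε²x²/2}` belong to `H(K)`. -/
theorem exists_gaussianRKHS_of_polynomial {ε : ℝ} (hε : 0 < ε) (p : ℝ[X]) :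
    ∃ f : GaussianRKHS ε,
      (∀ x : I, f x = Real.exp (-(1 / 2) * ε ^ 2 * (x : ℝ) ^ 2) * p.eval (x : ℝ)) ∧
      ‖f‖ ^ 2 ≤ ∑ j ∈ Finset.range (p.natDegree + 1),
        p.coeff j ^ 2 * monomialWeight (ε ^ 2) j := by
  obtain ⟨J, hJ, -, hf⟩ := exists_gaussianFeatureCLM ε 0
  -- Chosen so that `a k * expFeature ε x k` is the monomial `p.coeff k * x ^ k`; the adjoint of the
  -- contraction `J` then carries `a` to the function sought.
  set a : ℕ → ℝ := fun k => p.coeff k * (√(k ! : ℝ) / ε ^ k) with ha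
  have ha0 : ∀ k ∉ Finset.range (p.natDegree + 1), a k = 0 := fun k hk => by
    rw [ha]
    simp only
    rw [coeff_eq_zero_of_natDegree_lt (by simpa [Nat.lt_succ_iff] using hk), zero_mul]
  have hasq : ∀ k, a k ^ 2 = p.coeff k ^ 2 * monomialWeight (ε ^ 2) k := fun k => by
    rw [ha, monomialWeight]
    simp only
    rw [mul_pow, div_pow, Real.sq_sqrt (by positivity)]
    ring
  have hsum : HasSum (fun k => a k ^ 2)
      (∑ j ∈ Finset.range (p.natDegree + 1), p.coeff j ^ 2 * monomialWeight (ε ^ 2) j) := by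
    simp only [← hasq]
    exact hasSum_sum_of_ne_finset_zero fun k hk => by rw [ha0 k hk]; ring
  have hmem : Memℓp a 2 := memℓp_gen (by simpa using hsum.summable)
  set A : lp (fun _ : ℕ => ℝ) 2 := ⟨a, hmem⟩
  have hnA : ‖A‖ ^ 2 = ∑ j ∈ Finset.range (p.natDegree + 1),
      p.coeff j ^ 2 * monomialWeight (ε ^ 2) j := by
    have h : HasSum (fun k => ‖A k‖ ^ 2) (‖A‖ ^ 2) := by
      simpa using lp.hasSum_norm (p := 2) (by norm_num) A
    refine h.unique ?_
    simpa [A] using hsum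
  refine ⟨J.adjoint A, fun x => ?_, ?_⟩
  · rw [hf, inner_gaussianFeature_left, sub_zero]
    congr 1
    rw [tsum_eq_sum (s := Finset.range (p.natDegree + 1)) fun k hk => by
      change a k * _ = 0
      rw [ha0 k hk, zero_mul], eval_eq_sum_range]
    refine Finset.sum_congr rfl fun k _ => ?_
    change a k * _ = _
    have : √(k ! : ℝ) ≠ 0 := by positivity
    simp only [ha, expFeature, mul_pow]
    field_simp
  · rw [← hnA]
    gcongr
    have h := J.adjoint.le_of_opNorm_le (c := 1) (by rwa [LinearIsometryEquiv.norm_map]) A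
    simpa using h

theorem le_worstCaseError {ε : ℝ} {p : ℝ≥0∞} {n : ℕ} {A : LinearApprox n} {c : ℝ}
    {f : GaussianRKHS ε} (hf0 : f ≠ 0) (hf : ∀ k, f (A.point k) = 0)
    (hc : ENNReal.ofReal (c * ‖f‖) ≤ pNorm p f) :
    ENNReal.ofReal c ≤ worstCaseError ε p A := by
  refine le_iSup₂_of_le f hf0 ?_
  have h0 : A.apply f = 0 := by
    ext y
    simp [LinearApprox.apply, hf]
  rw [h0, sub_zero, ENNReal.le_div_iff_mul_le (Or.inl (by simpa using hf0)) (Or.inl (by simp)),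
    ← ofReal_norm, ← ENNReal.ofReal_mul' (norm_nonneg f)]
  exact hc

/-- The squared lower rate `((ε/2)^n (n!)^{-1/2})²`. -/
theorem lowerRate_sq {ε : ℝ} (hε : 0 < ε) (n : ℕ) :
    ((ε / 2) ^ n * (n ! : ℝ) ^ (-(1 / 2) : ℝ)) ^ 2 =
      (4 ^ n * monomialWeight (ε ^ 2) n)⁻¹ := by
  have hf0 : (0 : ℝ) < n ! := by positivity
  rw [mul_pow, ← Real.rpow_mul_natCast hf0.le, monomialWeight, div_pow, div_pow, ← pow_mul,
    ← pow_mul, mul_comm n 2, pow_mul, pow_mul]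
  have h1 : (n ! : ℝ) ^ (-(1 / 2) * ((2 : ℕ) : ℝ)) = (n ! : ℝ)⁻¹ := by
    rw [← Real.rpow_neg_one]; norm_num
  rw [h1]
  field_simp
  norm_num

theorem exp_neg_half_le {ε : ℝ} (x : I) :
    Real.exp (-(1 / 2) * ε ^ 2) ≤ Real.exp (-(1 / 2) * ε ^ 2 * (x : ℝ) ^ 2) := by
  apply Real.exp_le_exp.mpr
  have : (x : ℝ) ^ 2 ≤ 1 := (sq_le_one_iff_abs_le_one _).mpr (abs_le.mpr x.2)
  nlinarith [mul_nonneg (sq_nonneg ε) (sub_nonneg.mpr this)]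

/-- For `p = ∞`: `1/4` is the share of the leading coefficient, the bracket that of the lower ones.
The right side is the inverse square of `c_{1,∞}` without its factor `e^{-ε²/2}`. -/
theorem quarter_add_exp_sub_one_add_le {l : ℝ} (hl : 0 < l) :
    1 / 4 + (Real.exp (l ^ 2 / 16) - 1 + l / 4 * Real.exp (l ^ 2 / 16)) ≤
      (1 + l) / 2 * Real.exp (l ^ 2 / 16) := by
  have h1 := Real.one_le_exp (show 0 ≤ l ^ 2 / 16 by positivity)
  by_cases h : 2 ≤ l
  · nlinarith
  · have h2 : Real.exp (l ^ 2 / 16) ≤ 3 / 2 := by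
      have h3 : Real.exp (l ^ 2 / 16) ≤ Real.exp (1 / 4) := Real.exp_le_exp.mpr (by nlinarith)
      refine h3.trans (le_of_pow_le_pow_left₀ (n := 4) (by norm_num) (by positivity) ?_)
      rw [← Real.exp_nat_mul]
      norm_num
      linarith [Real.exp_one_lt_d9]
    nlinarith

/-- The lower error bound for `p ∈ {2, ∞}`. -/
theorem ofReal_cLower_le_worstCaseError {ε : ℝ} (hε : 0 < ε) {n : ℕ} (hn : mL (ε ^ 2) ≤ n)
    {p : ℝ≥0∞} (hp : p = 2 ∨ p = ∞) (A : LinearApprox n) :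
    ENNReal.ofReal (cLower p (ε ^ 2) (Real.exp (-(1 / 2) * ε ^ 2)) *
      (ε / 2) ^ n * (n ! : ℝ) ^ (-(1 / 2) : ℝ)) ≤ worstCaseError ε p A := by
  obtain ⟨h5, -, hn0⟩ := le_of_mL_le hε hn
  have hl : 0 < ε ^ 2 := by positivity
  set q : ℝ[X] := ∏ k, (X - C (A.point k : ℝ)) with hq
  have hmonic : q.Monic := monic_prod_of_monic _ _ fun k _ => monic_X_sub_C _
  have hdeg : q.natDegree = n := by
    rw [hq, natDegree_prod_of_monic _ _ fun k _ => monic_X_sub_C _]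
    simp
  have hcoeff : q.coeff n = 1 := by rw [← hdeg]; exact hmonic
  obtain ⟨f, hf, hfn⟩ := exists_gaussianRKHS_of_polynomial hε q
  rw [hdeg, Finset.sum_range_succ] at hfn
  have hW : 0 < 4 ^ n * monomialWeight (ε ^ 2) n :=
    mul_pos (by positivity) (monomialWeight_pos hl n)
  set W := 4 ^ n * monomialWeight (ε ^ 2) n with hWdef
  set γ := Real.exp (-(1 / 2) * ε ^ 2)
  have hγ0 : 0 < γ := Real.exp_pos _
  have hx : Real.exp (-(1 / 32) * (ε ^ 2) ^ 2) ^ 2 = (Real.exp ((ε ^ 2) ^ 2 / 16))⁻¹ := by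
    rw [← Real.exp_nat_mul, ← Real.exp_neg]; congr 1; push_cast; ring
  set E := Real.exp ((ε ^ 2) ^ 2 / 16)
  have hE : 0 < E := Real.exp_pos _
  have hroot : ∀ k, f (A.point k) = 0 := fun k => by
    rw [hf, hq, eval_prod, Finset.prod_eq_zero (Finset.mem_univ k) (by simp), mul_zero]
  have hf0 : f ≠ 0 := by
    rintro rfl
    refine hmonic.ne_zero (eq_zero_of_infinite_isRoot q ?_)
    refine (Set.Icc_infinite (show (-1 : ℝ) < 1 by norm_num)).mono fun y hy => ?_
    have := hf ⟨y, hy⟩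
    rw [RKHS.coe_zero, Pi.zero_apply, eq_comm, mul_eq_zero] at this
    exact this.resolve_left (Real.exp_pos _).ne'
  refine le_worstCaseError hf0 hroot ?_
  have hrate := lowerRate_sq hε n
  rw [← hWdef] at hrate
  rcases hp with rfl | rfl
  · set N := ∫ x in (-1 : ℝ)..1, q.eval x ^ 2 with hN'
    have hlow := le_pNorm_two (h := f) (F := fun x => γ ^ 2 * q.eval x ^ 2) (by fun_prop)
      (fun x => by positivity) fun x => by
        rw [hf, mul_pow]
        gcongr
        exact exp_neg_half_le x
    refine le_trans (ENNReal.ofReal_le_ofReal (Real.le_sqrt_of_sq_le ?_)) hlow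
    rw [intervalIntegral.integral_const_mul, ← hN']
    obtain ⟨hc1, hc2⟩ := coeff_sq_le_and_sum_coeff_sq_le hl hn0 h5 hdeg.le (B := 2 / Real.pi * N)
      ((integral_sq_eval_cos_mul_sin_le q).trans_eq (by field_simp; rfl))
    have hN : 0 ≤ N := intervalIntegral.integral_nonneg (by norm_num) fun _ _ => sq_nonneg _
    have hf2 : ‖f‖ ^ 2 ≤ 2 / Real.pi * N * W * (E * (1 + ε ^ 2 / 4)) := by
      have h1 := mul_le_mul_of_nonneg_right hc1 (monomialWeight_pos hl n).le
      rw [mul_assoc (2 / Real.pi * N), ← hWdef] at h1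
      rw [← hWdef] at hc2
      linarith
    rw [cLower, if_neg (by norm_num)]
    have hexp : (1 : ℝ) ≤ Real.exp 1 := Real.one_le_exp zero_le_one
    -- The argument yields `2π/(4+ε²)`; the stated constant leaves ample room.
    have hK : (2 * √(2 * Real.pi) / (3 * Real.exp 1 ^ 3 * √(4 + ε ^ 2))) ^ 2 ≤
        Real.pi / (2 * (1 + ε ^ 2 / 4)) := by
      rw [div_pow, mul_pow, mul_pow, mul_pow, Real.sq_sqrt (by positivity),
        Real.sq_sqrt (by positivity), div_le_div_iff₀ (by positivity) (by positivity)]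
      have h1 : 1 ≤ (Real.exp 1 ^ 3) ^ 2 := one_le_pow₀ (one_le_pow₀ hexp)
      have h2 : 0 ≤ Real.pi * (4 + ε ^ 2) := by positivity
      nlinarith [mul_le_mul_of_nonneg_right h1 h2]
    calc _ = (2 * √(2 * Real.pi) / (3 * Real.exp 1 ^ 3 * √(4 + ε ^ 2))) ^ 2 *
          (Real.exp (-(1 / 32) * (ε ^ 2) ^ 2) ^ 2 * γ ^ 2 *
          ((ε / 2) ^ n * (n ! : ℝ) ^ (-(1 / 2) : ℝ)) ^ 2 * ‖f‖ ^ 2) := by ring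
      _ ≤ Real.pi / (2 * (1 + ε ^ 2 / 4)) * (E⁻¹ * γ ^ 2 * W⁻¹ *
          (2 / Real.pi * N * W * (E * (1 + ε ^ 2 / 4)))) := by
          rw [hx, hrate]
          gcongr
      _ = _ := by field_simp
  · obtain ⟨y, hy, hmax⟩ := (isCompact_Icc (a := (-1 : ℝ)) (b := 1)).exists_isMaxOn
      ⟨0, by norm_num⟩ (f := fun x => |q.eval x|) (by fun_prop)
    set M := |q.eval y|
    have hM : ∀ x ∈ Set.Icc (-1 : ℝ) 1, |q.eval x| ≤ M := hmax
    have hM0 : 0 < M := by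
      refine (abs_nonneg _).lt_of_ne fun h => hf0 (RKHS.ext fun x => ?_)
      have := hM x x.2
      rw [hf, abs_nonpos_iff.mp (this.trans_eq h.symm), mul_zero, RKHS.coe_zero, Pi.zero_apply]
    -- Chebyshev's extremal property for `q/M` halves the bound from the `U_k` expansion; squared,
    -- this gives the `1/4`.
    have hlead : 1 ≤ M * (2 ^ n / 2) := by
      have h := Chebyshev.coeff_le_of_forall_abs_le_one (n := n) (P := C M⁻¹ * q)
        (degree_le_of_natDegree_le ((natDegree_C_mul_le _ _).trans hdeg.le)) fun x hx => by
          rw [eval_mul, eval_C, abs_mul, abs_of_pos (by positivity), inv_mul_le_iff₀ hM0, mul_one]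
          exact hM x hx
      rw [coeff_C_mul, hcoeff, mul_one, inv_le_iff_one_le_mul₀ hM0] at h
      refine h.trans_eq ?_
      obtain ⟨m, rfl⟩ := Nat.exists_eq_succ_of_ne_zero hn0
      rw [Nat.succ_eq_add_one, Nat.add_sub_cancel, pow_succ]
      ring
    obtain ⟨-, hc2⟩ := coeff_sq_le_and_sum_coeff_sq_le hl hn0 h5 hdeg.le
      (integral_sq_eval_cos_mul_sin_le_of_abs_le hM)
    have hf2 : ‖f‖ ^ 2 ≤ M ^ 2 * W * ((1 + ε ^ 2) / 2 * E) := by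
      have h1 : (1 : ℝ) ^ 2 ≤ (M * (2 ^ n / 2)) ^ 2 := by gcongr
      have h2 := mul_le_mul_of_nonneg_right h1 (monomialWeight_pos hl n).le
      have h3 : (M * (2 ^ n / 2)) ^ 2 * monomialWeight (ε ^ 2) n = M ^ 2 * W * (1 / 4) := by
        rw [hWdef, mul_pow, div_pow, ← pow_mul, mul_comm n 2, pow_mul]
        norm_num
        ring
      rw [← hWdef] at hc2
      have h4 := mul_le_mul_of_nonneg_left (quarter_add_exp_sub_one_add_le hl)
        (show 0 ≤ M ^ 2 * W by positivity)
      rw [hcoeff] at hfn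
      rw [h3] at h2
      linarith
    have hval : γ * M ≤ |f ⟨y, hy⟩| := by
      rw [hf, abs_mul, abs_of_pos (Real.exp_pos _)]
      exact mul_le_mul_of_nonneg_right (exp_neg_half_le ⟨y, hy⟩) (abs_nonneg _)
    rw [pNorm, if_pos rfl]
    refine le_iSup_of_le (⟨y, hy⟩ : I) ?_
    rw [Real.enorm_eq_ofReal_abs]
    refine ENNReal.ofReal_le_ofReal (le_trans (le_of_sq_le_sq ?_ (by positivity)) hval)
    rw [cLower, if_pos rfl]
    calc _ = √(2 / (1 + ε ^ 2)) ^ 2 * (Real.exp (-(1 / 32) * (ε ^ 2) ^ 2) ^ 2 * γ ^ 2 *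
          ((ε / 2) ^ n * (n ! : ℝ) ^ (-(1 / 2) : ℝ)) ^ 2 * ‖f‖ ^ 2) := by ring
      _ ≤ 2 / (1 + ε ^ 2) * (E⁻¹ * γ ^ 2 * W⁻¹ * (M ^ 2 * W * ((1 + ε ^ 2) / 2 * E))) := by
          rw [hx, hrate, Real.sq_sqrt (by positivity)]
          gcongr
      _ = _ := by field_simp

/-- Upper bounds for the minimal errors, from the Chebyshev nodes. -/
theorem minimalError_le {ε : ℝ} (hε : 0 < ε) {n : ℕ} (hn : mL (ε ^ 2) ≤ n) :
    minimalError ε ∞ n ≤ ENNReal.ofReal (2 * (1 / 2) ^ n * upperRate ε n) ∧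
    minimalError ε 2 n ≤ ENNReal.ofReal (√2 * (2 * (1 / 2) ^ n * upperRate ε n)) := by
  obtain ⟨x, hx, hxc⟩ := exists_chebyshev_nodes (le_of_mL_le hε hn).2.2
  obtain ⟨A, -, h1, h2⟩ := exists_linearApprox_of_prod_le hε hn hx (by positivity) hxc
  exact ⟨(iInf_le _ A).trans h1, (iInf_le _ A).trans h2⟩

end

end GaussApprox

end

/-! ### Assembly of the bounds -/

theorem theorem1p2 (ε : ℝ) (hε : 0 < ε) (n : ℕ) (hn : GaussApprox.mL (ε ^ 2) ≤ (n : ℝ)) :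
    -- the bounds for `p ∈ {2, ∞}`
    (∀ p : ℝ≥0∞, p = 2 ∨ p = ∞ →
      (ENNReal.ofReal (GaussApprox.cLower p (ε ^ 2) (Real.exp (-(1 / 2) * ε ^ 2)) *
            (ε / 2) ^ n * (n ! : ℝ) ^ (-(1 / 2) : ℝ))
          ≤ GaussApprox.minimalError ε p n ∧
        GaussApprox.minimalError ε p n
          ≤ ENNReal.ofReal (2 * √(2 * GaussApprox.cL (ε ^ 2)) * (n : ℝ) ^ (-(1 / 8) : ℝ) *
            Real.exp (ε * √n) * (ε / 2) ^ n * (n ! : ℝ) ^ (-(1 / 2) : ℝ))) ∧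
      ∀ x : Fin n → GaussApprox.I, Function.Injective x →
        ∃ A : GaussApprox.LinearApprox n, A.point = x ∧
          ENNReal.ofReal (GaussApprox.cLower p (ε ^ 2) (Real.exp (-(1 / 2) * ε ^ 2)) *
              (ε / 2) ^ n * (n ! : ℝ) ^ (-(1 / 2) : ℝ))
            ≤ GaussApprox.worstCaseError ε p A ∧
          GaussApprox.worstCaseError ε p A
            ≤ ENNReal.ofReal (√(2 * GaussApprox.cL (ε ^ 2)) *
              (n : ℝ) ^ (-(1 / 8) - (1 / p).toReal : ℝ) *
              Real.exp (ε * √n) * (2 * ε) ^ n * (n ! : ℝ) ^ (-(1 / 2) : ℝ))) ∧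
    -- the bounds for `p = ∞` with sharper constants
    (∀ c₁ c₂ : ℝ,
      c₁ = √(2 / (1 + ε ^ 2)) * Real.exp (-((1 / 32) * ε ^ 4 + (1 / 2) * ε ^ 2)) →
      c₂ = 2 * √(GaussApprox.cL (ε ^ 2)) →
      (ENNReal.ofReal (c₁ * (ε / 2) ^ n * (n ! : ℝ) ^ (-(1 / 2) : ℝ))
          ≤ GaussApprox.minimalError ε ∞ n ∧
        GaussApprox.minimalError ε ∞ n
          ≤ ENNReal.ofReal (c₂ * (n : ℝ) ^ (-(1 / 8) : ℝ) * Real.exp (ε * √n) *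
            (ε / 2) ^ n * (n ! : ℝ) ^ (-(1 / 2) : ℝ))) ∧
      ∀ x : Fin n → GaussApprox.I, Function.Injective x →
        ∃ A : GaussApprox.LinearApprox n, A.point = x ∧
          ENNReal.ofReal (c₁ * (ε / 2) ^ n * (n ! : ℝ) ^ (-(1 / 2) : ℝ))
            ≤ GaussApprox.worstCaseError ε ∞ A ∧
          GaussApprox.worstCaseError ε ∞ A
            ≤ ENNReal.ofReal (c₂ / 2 * (n : ℝ) ^ (-(1 / 8) : ℝ) * Real.exp (ε * √n) *
              (2 * ε) ^ n * (n ! : ℝ) ^ (-(1 / 2) : ℝ))) := by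
  obtain ⟨-, -, hn0⟩ := GaussApprox.le_of_mL_le hε hn
  have hnpos : (0 : ℝ) < n := by positivity
  have hc := GaussApprox.cL_nonneg (ε ^ 2) (by positivity)
  have hlow := fun p hp (A : GaussApprox.LinearApprox n) =>
    GaussApprox.ofReal_cLower_le_worstCaseError hε hn (p := p) hp A
  obtain ⟨hmin1, hmin2⟩ := GaussApprox.minimalError_le hε hn
  have hU := GaussApprox.upperRate_nonneg hε n
  have hmin : ENNReal.ofReal (2 * (1 / 2) ^ n * GaussApprox.upperRate ε n) = ENNReal.ofReal
      (2 * √(GaussApprox.cL (ε ^ 2)) * (n : ℝ) ^ (-(1 / 8) : ℝ) * Real.exp (ε * √n) * (ε / 2) ^ n *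
        (n ! : ℝ) ^ (-(1 / 2) : ℝ)) := by
    rw [GaussApprox.upperRate, div_pow, div_pow, one_pow]
    ring_nf
  have hmin' : ENNReal.ofReal (√2 * (2 * (1 / 2) ^ n * GaussApprox.upperRate ε n)) = ENNReal.ofReal
      (2 * √(2 * GaussApprox.cL (ε ^ 2)) * (n : ℝ) ^ (-(1 / 8) : ℝ) * Real.exp (ε * √n) * (ε / 2) ^ n *
        (n ! : ℝ) ^ (-(1 / 2) : ℝ)) := by
    rw [GaussApprox.upperRate, div_pow, div_pow, one_pow, Real.sqrt_mul (by norm_num)]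
    ring_nf
  -- The factor `√2` in (a) is needed for `p = 2`; for `p = ∞` it only weakens the sharper bound.
  have hsqrt2 : (1 : ℝ) ≤ √2 := Real.one_le_sqrt.mpr (by norm_num)
  have harb : 2 ^ n * GaussApprox.upperRate ε n = √(GaussApprox.cL (ε ^ 2)) * (n : ℝ) ^ (-(1 / 8) : ℝ) *
      Real.exp (ε * √n) * (2 * ε) ^ n * (n ! : ℝ) ^ (-(1 / 2) : ℝ) := by
    rw [GaussApprox.upperRate, mul_pow]
    ring
  have harb2 : √(2 / n) * (2 ^ n * GaussApprox.upperRate ε n) = √(2 * GaussApprox.cL (ε ^ 2)) *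
      (n : ℝ) ^ (-(1 / 8) - 1 / 2 : ℝ) *
      Real.exp (ε * √n) * (2 * ε) ^ n * (n ! : ℝ) ^ (-(1 / 2) : ℝ) := by
    rw [harb, Real.sqrt_mul (by norm_num), Real.sqrt_div (by norm_num), Real.rpow_sub hnpos,
      ← Real.sqrt_eq_rpow]
    ring
  refine ⟨fun p hp => ⟨⟨le_iInf (hlow p hp), ?_⟩, fun x hx => ?_⟩, fun c₁ c₂ h₁ h₂ => ?_⟩
  · rw [← hmin']
    rcases hp with rfl | rfl
    · exact hmin2
    · exact hmin1.trans (ENNReal.ofReal_le_ofReal (le_mul_of_one_le_left (by positivity) hsqrt2))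
  · obtain ⟨A, hA, h1, h2⟩ := GaussApprox.exists_linearApprox_of_injective hε hn hx
    refine ⟨A, hA, hlow p hp A, ?_⟩
    rcases hp with rfl | rfl
    · refine h2.trans_eq ?_
      rw [harb2]
      norm_num
    · refine h1.trans (ENNReal.ofReal_le_ofReal ?_)
      rw [harb, Real.sqrt_mul (by norm_num)]
      simp only [ENNReal.div_top, ENNReal.toReal_zero, sub_zero, mul_assoc]
      exact le_mul_of_one_le_left (by positivity) hsqrt2
  · have hc1 : c₁ = GaussApprox.cLower ∞ (ε ^ 2) (Real.exp (-(1 / 2) * ε ^ 2)) := by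
      rw [h₁, GaussApprox.cLower, if_pos rfl, mul_assoc, ← Real.exp_add]
      ring_nf
    rw [hc1, h₂]
    refine ⟨⟨le_iInf (hlow ∞ (Or.inr rfl)), hmin1.trans_eq hmin⟩, fun x hx => ?_⟩
    obtain ⟨A, hA, h1, -⟩ := GaussApprox.exists_linearApprox_of_injective hε hn hx
    refine ⟨A, hA, hlow ∞ (Or.inr rfl) A, h1.trans_eq ?_⟩
    rw [harb]
    ring_nf
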